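/- Let $\mu$ be a $2\pi$-periodic positive Borel measure on $\mathbb R$, finite on bounded sets, whose support in $[0,2\pi)$ is infinite. For $t>0$ let $PW_t$ be the Paley–Wiener space of entire functions $$f(z)=\frac1{\sqrt{2\pi}}\int_{-t}^{t}e^{-i\xi z}\varphi(\xi)\,d\xi,\qquad \varphi\in L^2[-t,t],$$ with the inner product of $L^2(\mathbb R)$, and let $L_{\mu,t}:PW_t\to PW_t$ be the truncated Toeplitz operator, that is, the bounded operator with $$(L_{\mu,t}f,g)_{L^2(\mathbb R)}=\int_{\mathbb R} f\,\overline g\,d\mu\qquad (f,g\in PW_t).$$ Put $$k_t=L_{\mu,t}^{-1}\mathring k_t,\qquad \mathring k_t(z)=\frac{\sin tz}{\pi z},\qquad h^\mu(t)=\pi\,\frac{d}{dt}k_t(0).$$ Let $\gamma_k=\frac1{2\pi}\int_{[0,2\pi)}e^{-ikx}\,d\mu(x)$, $k\in\mathbb Z$, be the trigonometric moments of $\mu$, let $\Gamma_n(\mu)$ be the $n\times n$ Toeplitz matrix with entry $\gamma_{k-j}$ in row $j$ and column $k$, and let $\Sigma[A]$ denote the sum of all entries of a matrix $A$ (so that $\Sigma$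 of the empty matrix $\Gamma_0(\mu)^{-1}$ is $0$). Then for every $t>0$ one has $PW_t\subset L^2(\mu)$, the operator $L_{\mu,t}$ exists and is invertible with bounded inverse, and every matrix $\Gamma_n(\mu)$ is invertible. Moreover, there are real numbers $h_0,h_1,h_2,\dots$ such that for every $n\ge 0$ and every $t\in\left(\frac n2,\frac{n+1}2\right)$ the function $s\mapsto k_s(0)$ is differentiable at $t$ and $h^\mu(t)=h_n$, where $$h_n=\Sigma\left[\Gamma_{n+1}(\mu)^{-1}\right]-\Sigma\left[\Gamma_n(\mu)^{-1}\right]\quad(n\ge0),\qquad h_0=\Sigma\left[\Gamma_1(\mu)^{-1}\right]=\gamma_0^{-1}.$$ -/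

import Mathlib

open MeasureTheory Set
open scoped FourierTransform ComplexConjugate InnerProductSpace

noncomputable section

namespace PWInverse

/-! ### Paley–Wiener spaces -/

/-- The entire function `z ↦ (2π)^{-1/2} ∫_{-t}^{t} e^{-iξz} φ(ξ) dξ`. -/
def fourierExt (t : ℝ) (φ : ℝ → ℂ) : ℂ → ℂ := fun z =>
  ((1 / Real.sqrt (2 * Real.pi) : ℝ) : ℂ) *
    ∫ ξ in Icc (-t) t, Complex.exp (-(Complex.I * (ξ : ℂ) * z)) * φ ξ

theorem integrableOn_of_memLp {t : ℝ} {φ : ℝ → ℂ}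
    (h : MemLp φ 2 (volume.restrict (Icc (-t) t))) : IntegrableOn φ (Icc (-t) t) :=
  h.integrable (by norm_num)

theorem integrable_exp_mul {t : ℝ} {φ : ℝ → ℂ}
    (h : MemLp φ 2 (volume.restrict (Icc (-t) t))) (z : ℂ) :
    IntegrableOn (fun ξ : ℝ => Complex.exp (-(Complex.I * (ξ : ℂ) * z)) * φ ξ) (Icc (-t) t) := by
  refine (integrableOn_of_memLp h).continuousOn_mul ?_ isCompact_Icc
  fun_prop

/-- The Paley–Wiener space `PW_t` as a linear space of functions on `ℂ`: the image of
`L²[-t, t]` under the (unitarily normalized) Fourier transform. -/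
def paleyWiener (t : ℝ) : Submodule ℂ (ℂ → ℂ) where
  carrier := {f | ∃ φ : ℝ → ℂ, MemLp φ 2 (volume.restrict (Icc (-t) t)) ∧ f = fourierExt t φ}
  zero_mem' := ⟨0, MemLp.zero, by funext z; simp [fourierExt]⟩
  add_mem' := by
    rintro _ _ ⟨φ, hφ, rfl⟩ ⟨ψ, hψ, rfl⟩
    refine ⟨φ + ψ, hφ.add hψ, ?_⟩
    funext z
    simp only [fourierExt, Pi.add_apply, mul_add]
    rw [integral_add (integrable_exp_mul hφ z) (integrable_exp_mul hψ z), mul_add]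
  smul_mem' := by
    rintro c _ ⟨φ, hφ, rfl⟩
    refine ⟨c • φ, hφ.const_smul c, ?_⟩
    funext z
    simp only [fourierExt, Pi.smul_apply, smul_eq_mul]
    rw [← mul_assoc, mul_comm c, mul_assoc, ← integral_const_mul]
    congr 2
    funext ξ
    ring

/-- `PW_t` as a type of its own, so that it carries only the topology of `L²(ℝ)`. -/
def PaleyWiener (t : ℝ) : Type := ↥(paleyWiener t)

instance (t : ℝ) : AddCommGroup (PaleyWiener t) := inferInstanceAs (AddCommGroup ↥(paleyWiener t))

instance (t : ℝ) : Module ℂ (PaleyWiener t) := inferInstanceAs (Module ℂ ↥(paleyWiener t))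

/-- The underlying function on `ℂ`. -/
def PaleyWiener.fn {t : ℝ} (f : PaleyWiener t) : ℂ → ℂ := Subtype.val f

instance (t : ℝ) : CoeFun (PaleyWiener t) (fun _ => ℂ → ℂ) := ⟨PaleyWiener.fn⟩

theorem PaleyWiener.ext {t : ℝ} {f g : PaleyWiener t} (h : ∀ z, f z = g z) : f = g :=
  Subtype.ext (funext h)

@[simp] theorem PaleyWiener.add_apply {t : ℝ} (f g : PaleyWiener t) (z : ℂ) :
    (f + g) z = f z + g z := rfl

@[simp] theorem PaleyWiener.smul_apply {t : ℝ} (c : ℂ) (f : PaleyWiener t) (z : ℂ) :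
    (c • f) z = c * f z := rfl

@[simp] theorem PaleyWiener.zero_apply {t : ℝ} (z : ℂ) : (0 : PaleyWiener t) z = 0 := rfl

/-! ### The Fourier transform of a function in `L¹ ∩ L²` -/

/-- The Fourier integral of a function in `L¹ ∩ L²` represents its `L²` Fourier transform. -/
theorem fourier_ae_eq {g : ℝ → ℂ} (h1 : Integrable g) (h2 : MemLp g 2 volume) :
    (𝓕 g : ℝ → ℂ) =ᵐ[volume] ((𝓕 (h2.toLp g) : Lp ℂ 2 (volume : Measure ℝ)) : ℝ → ℂ) := by
  have hcont : Continuous (𝓕 g : ℝ → ℂ) :=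
    VectorFourier.fourierIntegral_continuous Real.continuous_fourierChar
      (by exact continuous_inner) h1
  refine ae_eq_of_integral_contDiff_smul_eq hcont.locallyIntegrable
    ((Lp.memLp _).locallyIntegrable (by norm_num)) ?_
  intro ψ ψ_smooth ψ_cpt
  have hψ1 : HasCompactSupport (Complex.ofRealCLM ∘ ψ) := ψ_cpt.comp_left rfl
  have hψ2 : ContDiff ℝ (⊤ : ℕ∞) (Complex.ofRealCLM ∘ ψ) := by fun_prop
  set s := hψ1.toSchwartzMap hψ2 with hs
  have e1 := Lp.fourier_toTemperedDistribution_eq (h2.toLp g)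
  have e2 := DFunLike.congr_fun e1 s
  rw [TemperedDistribution.fourier_apply, Lp.toTemperedDistribution_apply,
    Lp.toTemperedDistribution_apply] at e2
  have e3 : ∫ x, (𝓕 s : SchwartzMap ℝ ℂ) x • (h2.toLp g : ℝ → ℂ) x
      = ∫ x, (𝓕 s : SchwartzMap ℝ ℂ) x • g x := by
    refine integral_congr_ae ?_
    filter_upwards [h2.coeFn_toLp] with x hx
    rw [hx]
  rw [e3] at e2
  have e4 : ∫ x, (𝓕 g x) • s x = ∫ x, g x • (𝓕 (s : ℝ → ℂ)) x := by
    have := VectorFourier.integral_fourierIntegral_smul_eq_flip (μ := volume) (ν := volume)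
      (L := innerₗ ℝ) Real.continuous_fourierChar continuous_inner h1 s.integrable
    rw [flip_innerₗ] at this
    exact this
  have l1 : ∫ x, ψ x • 𝓕 g x = ∫ x, (𝓕 g x) • s x := by
    congr 1
    funext x
    simp [hs, mul_comm]
  have l2 : ∫ x, ψ x • ((𝓕 (h2.toLp g) : Lp ℂ 2 (volume : Measure ℝ)) : ℝ → ℂ) x
      = ∫ x, s x • ((𝓕 (h2.toLp g) : Lp ℂ 2 (volume : Measure ℝ)) : ℝ → ℂ) x := by
    congr 1
  rw [l1, l2, ← e2, e4]
  congr 1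
  funext x
  rw [SchwartzMap.fourier_coe, smul_eq_mul, smul_eq_mul, mul_comm]

theorem fourierExt_ofReal (t : ℝ) (φ : ℝ → ℂ) (x : ℝ) :
    fourierExt t φ (x : ℂ) = ((1 / Real.sqrt (2 * Real.pi) : ℝ) : ℂ) *
      𝓕 ((Icc (-t) t).indicator φ) ((2 * Real.pi)⁻¹ * x) := by
  rw [Real.fourier_eq', fourierExt]
  congr 1
  rw [← integral_indicator measurableSet_Icc]
  congr 1
  funext ξ
  by_cases hξ : ξ ∈ Icc (-t) t
  · rw [indicator_of_mem hξ, indicator_of_mem hξ, smul_eq_mul]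
    congr 2
    have : (Real.pi : ℂ) ≠ 0 := by exact_mod_cast Real.pi_ne_zero
    simp
    field_simp
  · rw [indicator_of_notMem hξ, indicator_of_notMem hξ, smul_zero]

theorem memLp_fourierExt {t : ℝ} {φ : ℝ → ℂ} (h : MemLp φ 2 (volume.restrict (Icc (-t) t))) :
    MemLp (fun x : ℝ => fourierExt t φ (x : ℂ)) 2 volume := by
  have h2 : MemLp ((Icc (-t) t).indicator φ) 2 volume :=
    (memLp_indicator_iff_restrict measurableSet_Icc).mpr h
  have h1 : Integrable ((Icc (-t) t).indicator φ) :=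
    (integrable_indicator_iff measurableSet_Icc).mpr (integrableOn_of_memLp h)
  have h3 : MemLp (𝓕 ((Icc (-t) t).indicator φ) : ℝ → ℂ) 2 volume :=
    (Lp.memLp _).ae_eq (fourier_ae_eq h1 h2).symm
  have hc : (2 * Real.pi)⁻¹ ≠ 0 := by positivity
  have h4 : MemLp (fun x : ℝ => 𝓕 ((Icc (-t) t).indicator φ) ((2 * Real.pi)⁻¹ * x)) 2 volume := by
    have hm := Real.map_volume_mul_left hc
    have h5 : MemLp (𝓕 ((Icc (-t) t).indicator φ) : ℝ → ℂ) 2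
        (Measure.map (fun x : ℝ => (2 * Real.pi)⁻¹ * x) volume) := by
      rw [hm]
      exact h3.smul_measure ENNReal.ofReal_ne_top
    exact h5.comp_of_map (by fun_prop)
  simp only [fourierExt_ofReal]
  exact h4.const_mul _

theorem fourierExt_eq_zero {t : ℝ} {φ : ℝ → ℂ} (h : MemLp φ 2 (volume.restrict (Icc (-t) t)))
    (h0 : (fun x : ℝ => fourierExt t φ (x : ℂ)) =ᵐ[volume] 0) : fourierExt t φ = 0 := by
  have h2 : MemLp ((Icc (-t) t).indicator φ) 2 volume :=
    (memLp_indicator_iff_restrict measurableSet_Icc).mpr h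
  have h1 : Integrable ((Icc (-t) t).indicator φ) :=
    (integrable_indicator_iff measurableSet_Icc).mpr (integrableOn_of_memLp h)
  have hc : (2 * Real.pi)⁻¹ ≠ 0 := by positivity
  have hs : ((1 / Real.sqrt (2 * Real.pi) : ℝ) : ℂ) ≠ 0 := by
    have : (1 / Real.sqrt (2 * Real.pi) : ℝ) ≠ 0 := by positivity
    exact_mod_cast this
  have h3 : (fun x : ℝ => 𝓕 ((Icc (-t) t).indicator φ) ((2 * Real.pi)⁻¹ * x)) =ᵐ[volume] 0 := by
    filter_upwards [h0] with x hx
    rw [fourierExt_ofReal] at hx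
    exact (mul_eq_zero.mp hx).resolve_left hs
  have hq : Measure.QuasiMeasurePreserving (fun x : ℝ => ((2 * Real.pi)⁻¹)⁻¹ * x) volume volume := by
    refine ⟨by fun_prop, ?_⟩
    rw [Real.map_volume_mul_left (inv_ne_zero hc)]
    exact Measure.smul_absolutelyContinuous
  have h4 : (𝓕 ((Icc (-t) t).indicator φ) : ℝ → ℂ) =ᵐ[volume] 0 := by
    filter_upwards [hq.ae h3] with x hx
    rwa [mul_inv_cancel_left₀ hc] at hx
  have h5 : (𝓕 (h2.toLp _) : Lp ℂ 2 (volume : Measure ℝ)) = 0 := by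
    rw [Lp.eq_zero_iff_ae_eq_zero]
    exact (fourier_ae_eq h1 h2).symm.trans h4
  have h6 : h2.toLp _ = 0 := by
    rw [← norm_eq_zero, ← Lp.norm_fourier_eq, h5, norm_zero]
  have h7 : (Icc (-t) t).indicator φ =ᵐ[volume] 0 := by
    refine h2.coeFn_toLp.symm.trans ?_
    rw [h6]
    exact Lp.coeFn_zero _ _ _
  have h8 : φ =ᵐ[volume.restrict (Icc (-t) t)] 0 :=
    (indicator_ae_eq_restrict measurableSet_Icc).symm.trans (ae_restrict_of_ae h7)
  funext z
  simp only [fourierExt, Pi.zero_apply]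
  rw [integral_congr_ae (g := fun _ => (0 : ℂ)), integral_zero, mul_zero]
  filter_upwards [h8] with ξ hξ
  simp [hξ]

/-- Functions in `PW_t` are square integrable on the real line. -/
theorem PaleyWiener.memLp {t : ℝ} (f : PaleyWiener t) :
    MemLp (fun x : ℝ => f (x : ℂ)) 2 volume := by
  obtain ⟨_, φ, hφ, rfl⟩ := f
  exact memLp_fourierExt hφ

theorem PaleyWiener.eq_zero {t : ℝ} (f : PaleyWiener t)
    (h0 : (fun x : ℝ => f (x : ℂ)) =ᵐ[volume] 0) : f = 0 := by
  obtain ⟨_, φ, hφ, rfl⟩ := f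
  exact Subtype.ext (fourierExt_eq_zero hφ h0)

theorem PaleyWiener.integrable_mul {t : ℝ} (f g : PaleyWiener t) :
    Integrable (fun x : ℝ => conj (f (x : ℂ)) * g (x : ℂ)) volume :=
  MemLp.integrable_mul (p := 2) (q := 2) f.memLp.star g.memLp

/-- The inner product of `PW_t`, inherited from `L²(ℝ)` (conjugate-linear in the first slot). -/
@[reducible] def PaleyWiener.core (t : ℝ) : InnerProductSpace.Core ℂ (PaleyWiener t) where
  inner f g := ∫ x : ℝ, conj (f (x : ℂ)) * g (x : ℂ)
  conj_inner_symm f g := by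
    rw [← integral_conj]
    congr 1
    funext x
    simp [mul_comm]
  re_inner_nonneg f := by
    have : ∀ x : ℝ, conj (f (x : ℂ)) * f (x : ℂ) = ((‖f (x : ℂ)‖ ^ 2 : ℝ) : ℂ) := by
      intro x
      rw [Complex.conj_mul']
      push_cast
      rfl
    simp only [this]
    rw [integral_complex_ofReal]
    exact integral_nonneg (fun x => by positivity)
  add_left f g h := by
    simp only [PaleyWiener.add_apply, map_add, add_mul]
    exact integral_add (f.integrable_mul h) (g.integrable_mul h)
  smul_left f g c := by
    simp only [PaleyWiener.smul_apply, map_mul, mul_assoc]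
    exact integral_const_mul _ _
  definite f hf := by
    have : ∀ x : ℝ, conj (f (x : ℂ)) * f (x : ℂ) = ((‖f (x : ℂ)‖ ^ 2 : ℝ) : ℂ) := by
      intro x
      rw [Complex.conj_mul']
      push_cast
      rfl
    simp only [this] at hf
    rw [integral_complex_ofReal] at hf
    have hf' := Complex.ofReal_eq_zero.mp hf
    have hi : Integrable (fun x : ℝ => ‖f (x : ℂ)‖ ^ 2) volume := f.memLp.integrable_norm_pow (by norm_num)
    rw [integral_eq_zero_iff_of_nonneg (fun x => by positivity) hi] at hf'
    refine f.eq_zero ?_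
    filter_upwards [hf'] with x hx
    simpa using hx

instance (t : ℝ) : NormedAddCommGroup (PaleyWiener t) :=
  (PaleyWiener.core t).toNormedAddCommGroup

instance (t : ℝ) : InnerProductSpace ℂ (PaleyWiener t) :=
  InnerProductSpace.ofCore (PaleyWiener.core t).toCore

theorem PaleyWiener.inner_def {t : ℝ} (f g : PaleyWiener t) :
    ⟪f, g⟫_ℂ = ∫ x : ℝ, conj (f (x : ℂ)) * g (x : ℂ) := rfl

/-- The reproducing kernel of `PW_t` at the point `0`, the function `z ↦ sin(tz) / (πz)`; it is the
Fourier transform of the constant `(2π)^{-1/2}` on `[-t, t]`. -/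
def sincKernel (t : ℝ) : PaleyWiener t :=
  ⟨fourierExt t (fun _ => ((1 / Real.sqrt (2 * Real.pi) : ℝ) : ℂ)),
    _, memLp_const _, rfl⟩

theorem sincKernel_apply {t : ℝ} (ht : 0 ≤ t) {z : ℂ} (hz : z ≠ 0) :
    sincKernel t z = (1 / Real.pi) * (Complex.sin (t * z) / z) := by
  change ((1 / Real.sqrt (2 * Real.pi) : ℝ) : ℂ) * ∫ ξ in Icc (-t) t,
    Complex.exp (-(Complex.I * (ξ : ℂ) * z)) * ((1 / Real.sqrt (2 * Real.pi) : ℝ) : ℂ) = _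
  rw [integral_mul_const, integral_Icc_eq_integral_Ioc,
    ← intervalIntegral.integral_of_le (by linarith)]
  have h1 : ∀ ξ : ℝ, -(Complex.I * (ξ : ℂ) * z) = (-(Complex.I * z)) * ξ := fun ξ => by ring
  simp only [h1]
  rw [integral_exp_mul_complex (neg_ne_zero.mpr (mul_ne_zero Complex.I_ne_zero hz))]
  have h2 : ((1 / Real.sqrt (2 * Real.pi) : ℝ) : ℂ) * ((1 / Real.sqrt (2 * Real.pi) : ℝ) : ℂ)
      = 1 / (2 * Real.pi) := by
    rw [← Complex.ofReal_mul, div_mul_div_comm, Real.mul_self_sqrt (by positivity)]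
    push_cast
    ring
  rw [mul_comm _ ((1 / Real.sqrt (2 * Real.pi) : ℝ) : ℂ), ← mul_assoc, h2, Complex.sin]
  have e1 : -(Complex.I * z) * (t : ℂ) = -(t * z) * Complex.I := by ring
  have e2 : -(Complex.I * z) * ((-t : ℝ) : ℂ) = (t * z) * Complex.I := by push_cast; ring
  rw [e1, e2]
  have hpi : (Real.pi : ℂ) ≠ 0 := by exact_mod_cast Real.pi_ne_zero
  field_simp
  linear_combination (-Complex.exp (-(t * z * Complex.I)) + Complex.exp (t * z * Complex.I)) *
    Complex.I_sq

/-! ### Truncated Toeplitz operators and the function `h^μ` -/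

/-- `L` is the truncated Toeplitz operator of `μ` on `PW_t`: `PW_t ⊆ L²(μ)` and `L` is the bounded
operator on `PW_t` with `(L f, g)_{L²(ℝ)} = ∫ f conj(g) dμ`. -/
structure IsTruncatedToeplitz (μ : Measure ℝ) (t : ℝ) (L : PaleyWiener t →L[ℂ] PaleyWiener t) :
    Prop where
  memLp : ∀ f : PaleyWiener t, MemLp (fun x : ℝ => f (x : ℂ)) 2 μ
  inner_eq : ∀ f g : PaleyWiener t,
    ⟪g, L f⟫_ℂ = ∫ x : ℝ, f (x : ℂ) * conj (g (x : ℂ)) ∂μ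

theorem IsTruncatedToeplitz.unique {μ : Measure ℝ} {t : ℝ}
    {L L' : PaleyWiener t →L[ℂ] PaleyWiener t}
    (h : IsTruncatedToeplitz μ t L) (h' : IsTruncatedToeplitz μ t L') : L = L' := by
  ext1 f
  exact ext_inner_left ℂ fun g => by rw [h.inner_eq, h'.inner_eq]

open Classical in
/-- The truncated Toeplitz operator `L_{μ,t}` (with value `0` if there is none). -/
def truncatedToeplitz (μ : Measure ℝ) (t : ℝ) : PaleyWiener t →L[ℂ] PaleyWiener t :=
  if h : ∃ L, IsTruncatedToeplitz μ t L then h.choose else 0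

theorem IsTruncatedToeplitz.eq {μ : Measure ℝ} {t : ℝ} {L : PaleyWiener t →L[ℂ] PaleyWiener t}
    (h : IsTruncatedToeplitz μ t L) : truncatedToeplitz μ t = L := by
  have hex : ∃ L, IsTruncatedToeplitz μ t L := ⟨L, h⟩
  rw [truncatedToeplitz, dif_pos hex]
  exact hex.choose_spec.unique h

/-- `k_t = L_{μ,t}⁻¹ (sin(tz) / (πz))`, with the inverse taken in the ring of bounded operators
on `PW_t`. -/
def kernelAtZero (μ : Measure ℝ) (t : ℝ) : PaleyWiener t :=
  Ring.inverse (truncatedToeplitz μ t) (sincKernel t)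

/-- `h^μ(t) = π (d/dt) k_t(0)`. -/
def hFun (μ : Measure ℝ) (t : ℝ) : ℂ :=
  Real.pi * deriv (fun s : ℝ => kernelAtZero μ s 0) t

/-! ### Periodic measures and their moments -/

/-- The class `M⁺(𝕋)`: `2π`-periodic positive measures on `ℝ`, finite on bounded sets, whose support
in a period is infinite. -/
structure MPlusCircle (μ : Measure ℝ) : Prop where
  locallyFinite : IsLocallyFiniteMeasure μ
  periodic : μ.map (fun x => x + 2 * Real.pi) = μ
  support_infinite : (μ.support ∩ Ico 0 (2 * Real.pi)).Infinite

/-- The trigonometric moment `γ_k = (2π)⁻¹ ∫_{[0, 2π)} e^{-ikx} dμ(x)`. -/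
def moment (μ : Measure ℝ) (k : ℤ) : ℂ :=
  (1 / (2 * Real.pi)) * ∫ x in Ico 0 (2 * Real.pi), Complex.exp (-(Complex.I * k * x)) ∂μ

/-- The `n × n` Toeplitz matrix `Γ_n(μ)`, with entry `γ_{k-j}` in row `j` and column `k`. -/
def toeplitzMatrix (μ : Measure ℝ) (n : ℕ) : Matrix (Fin n) (Fin n) ℂ :=
  Matrix.of fun j k => moment μ ((k : ℤ) - (j : ℤ))

/-- The sum of all entries of a matrix. -/
def entrySum {n : ℕ} (A : Matrix (Fin n) (Fin n) ℂ) : ℂ := ∑ j, ∑ k, A j k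

end PWInverse

end

/-! The operator `L_{μ,t}` is a direct integral of finite Toeplitz matrices. Write `f ∈ PW_t`
through its density `φ` and cut `[-t, t]` into the fibers `φ_j(η) = φ(-t + η + j)`, `0 ≤ η < 1`. At
the points `x + 2πm` the factor `e^{-2πimj}` is `1`, so up to a unimodular factor `f(x + 2πm)` is
`(2π)^{-1/2}` times the `m`-th Fourier coefficient on `[0, 1]` of `e^{-iηx} ∑_j e^{-ijx} φ_j(η)`
(`fourierExt_add_period`). Parseval in `m`, integration of `x` over one period of `μ`, and
polarization give `∫ f conj(g) dμ = ∑_{j,l} γ_{j-l} ∫_0^1 φ_j conj(ψ_l) dη`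
(`integral_fourierExt_mul_conj`). For each `η` this is the form of a Toeplitz matrix `Γ_N(μ)`, where
`N` counts the points of `η + ℤ` in `[0, 2t]`.

Infinite support makes these forms positive definite: a nonzero polynomial in `e^{-ix}` has only
finitely many zeros in a period. Two-sided bounds on `ℂ^N` integrate over `η` to two-sided bounds on
`PW_t` (`MPlusCircle.exists_integral_bounds`), whence existence and invertibility of `L_{μ,t}`.

The function `sin(tz)/(πz)` has constant density `(2π)^{-1/2}`, so the density of `k_t` on the fiber
over `η` is `(2π)^{-1/2} Γ_N⁻¹(1, …, 1)` (`MPlusCircle.kernelAtZero_eq`). With `n = ⌊2t⌋`, the size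
`N` is `n + 1` on a set of `η` of length `2t - n` and `n` on the rest. Hence `2π k_t(0) = (2t - n)
Σ[Γ_{n+1}⁻¹] + (n + 1 - 2t) Σ[Γ_n⁻¹]`, which is affine in `t` between consecutive half-integers; its
slope gives `h_n`. -/

noncomputable section

namespace PWInverse

/-! ### Folding a function on `[-t, t]` over unit intervals -/

/-- The `j`-th fiber of a function on `[-t, t]`, extended by zero: `η ↦ φ(-t + η + j)`. -/
def fiber (t : ℝ) (φ : ℝ → ℂ) (j : ℕ) (η : ℝ) : ℂ := (Icc (-t) t).indicator φ (-t + η + j)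

theorem measurePreserving_fiber_shift (t : ℝ) (j : ℕ) :
    MeasurePreserving (fun η : ℝ => -t + η + j) volume volume :=
  (measurePreserving_add_right volume (j : ℝ)).comp (measurePreserving_add_left volume (-t))

theorem memLp_fiber {t : ℝ} {φ : ℝ → ℂ} (h : MemLp φ 2 (volume.restrict (Icc (-t) t))) (j : ℕ) :
    MemLp (fiber t φ j) 2 volume :=
  ((memLp_indicator_iff_restrict measurableSet_Icc).mpr h).comp_measurePreserving
    (measurePreserving_fiber_shift t j)

theorem integrable_fiber {t : ℝ} {F : ℝ → ℂ} (h : IntegrableOn F (Icc (-t) t)) (j : ℕ) :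
    Integrable (fiber t F j) volume :=
  (measurePreserving_fiber_shift t j).integrable_comp_of_integrable
    ((integrable_indicator_iff measurableSet_Icc).mpr h)

theorem fiber_mul (t : ℝ) (F G : ℝ → ℂ) (j : ℕ) (η : ℝ) :
    fiber t (fun ξ => F ξ * G ξ) j η = F (-t + η + j) * fiber t G j η := by
  by_cases h : -t + η + j ∈ Icc (-t) t
  · simp only [fiber, indicator_of_mem h]
  · simp only [fiber, indicator_of_notMem h, mul_zero]

theorem fiber_mul_conj (t : ℝ) (F G : ℝ → ℂ) (j : ℕ) (η : ℝ) :
    fiber t (fun ξ => F ξ * conj (G ξ)) j η = fiber t F j η * conj (fiber t G j η) := by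
  by_cases h : -t + η + j ∈ Icc (-t) t
  · simp only [fiber, indicator_of_mem h]
  · simp only [fiber, indicator_of_notMem h, zero_mul]

theorem fiber_add_const_mul (t : ℝ) (φ ψ : ℝ → ℂ) (c : ℂ) (j : ℕ) (η : ℝ) :
    fiber t (fun ξ => φ ξ + c * ψ ξ) j η = fiber t φ j η + c * fiber t ψ j η := by
  by_cases h : -t + η + j ∈ Icc (-t) t
  · simp only [fiber, indicator_of_mem h]
  · simp only [fiber, indicator_of_notMem h, mul_zero, add_zero]

theorem intervalIntegral_eq_sum_unit {F : ℝ → ℂ} (hF : Integrable F) (a : ℝ) (N : ℕ) :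
    ∫ x in a..a + N, F x = ∑ j ∈ Finset.range N, ∫ η in (0 : ℝ)..1, F (a + η + j) := by
  have h := intervalIntegral.sum_integral_adjacent_intervals (f := F) (μ := volume)
    (a := fun k : ℕ => a + k) (n := N) (fun k _ => hF.intervalIntegrable)
  simp only [Nat.cast_zero, add_zero] at h
  rw [← h]
  refine Finset.sum_congr rfl fun j _ => ?_
  have e : ∀ η : ℝ, F (a + η + j) = F (η + (a + j)) := fun η => by congr 1; ring
  simp only [e]
  rw [intervalIntegral.integral_comp_add_right (fun x => F x)]
  congr 1
  · ring
  · push_cast; ring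

theorem setIntegral_Icc_eq_sum_fiber {t : ℝ} {F : ℝ → ℂ} (hF : IntegrableOn F (Icc (-t) t))
    {N : ℕ} (hN : 2 * t ≤ N) :
    ∫ ξ in Icc (-t) t, F ξ = ∑ j ∈ Finset.range N, ∫ η in (0 : ℝ)..1, fiber t F j η := by
  have hG : Integrable ((Icc (-t) t).indicator F) := (integrable_indicator_iff measurableSet_Icc).mpr hF
  have h := intervalIntegral_eq_sum_unit hG (-t) N
  simp only [fiber]
  rw [← h, intervalIntegral.integral_of_le (by simp), ← integral_Icc_eq_integral_Ioc,
    setIntegral_indicator measurableSet_Icc]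
  congr 2
  rw [eq_comm, inter_eq_right]
  exact Icc_subset_Icc le_rfl (by linarith)

/-! ### Unfolding an integral against a periodic measure -/

theorem measurePreserving_add_int_mul {μ : Measure ℝ} {p : ℝ}
    (h : μ.map (fun x => x + p) = μ) (m : ℤ) : MeasurePreserving (fun x : ℝ => x + m * p) μ μ := by
  have h1 : MeasurePreserving (MeasurableEquiv.addRight p) μ μ := ⟨by fun_prop, h⟩
  have h2 : MeasurePreserving (fun x : ℝ => x + -p) μ μ := by
    have := h1.symm
    exact this
  have h1' : MeasurePreserving (fun x : ℝ => x + p) μ μ := h1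
  induction m with
  | zero => simpa [Function.id_def] using MeasurePreserving.id μ
  | succ k ih =>
    convert h1'.comp ih using 2 with x
    simp only [Function.comp_apply]; push_cast; ring
  | pred k ih =>
    convert h2.comp ih using 2 with x
    simp only [Function.comp_apply]; push_cast; ring

/-- The intervals `[mp, (m+1)p)` tile the line, and invariance moves each of them back to `[0, p)`.
-/
theorem lintegral_eq_setLIntegral_tsum {μ : Measure ℝ} {p : ℝ} (hp : 0 < p)
    (h : μ.map (fun x => x + p) = μ) {F : ℝ → ENNReal} (hF : Measurable F) :
    ∫⁻ x, F x ∂μ = ∫⁻ x in Ico 0 p, ∑' m : ℤ, F (x + m * p) ∂μ := by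
  rw [lintegral_tsum (f := fun (m : ℤ) (x : ℝ) => F (x + m * p))
      (fun m => (hF.comp (by fun_prop : Measurable fun x : ℝ => x + m * p)).aemeasurable),
    ← setLIntegral_univ, ← iUnion_Ico_add_zsmul hp 0, lintegral_iUnion (fun _ => measurableSet_Ico)]
  · congr 1
    funext m
    rw [← (measurePreserving_add_int_mul h m).setLIntegral_comp_preimage measurableSet_Ico hF]
    congr 2
    ext x
    simp only [mem_preimage, mem_Ico, zsmul_eq_mul]
    push_cast
    constructor <;> rintro ⟨h1, h2⟩ <;> constructor <;> linarith
  · exact pairwise_disjoint_Ico_add_zsmul 0 p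

/-! ### Parseval on the fibers -/

/-- The function `η ↦ ∑_{j<N} e^{-ijx} φ(-t + η + j)`. -/
def fiberSum (t : ℝ) (N : ℕ) (φ : ℝ → ℂ) (x η : ℝ) : ℂ :=
  ∑ j ∈ Finset.range N, Complex.exp (-(Complex.I * j * x)) * fiber t φ j η

theorem memLp_fiberSum {t : ℝ} {φ : ℝ → ℂ} (h : MemLp φ 2 (volume.restrict (Icc (-t) t)))
    (N : ℕ) (x : ℝ) : MemLp (fiberSum t N φ x) 2 volume :=
  memLp_finsetSum _ fun j _ => (memLp_fiber h j).const_mul _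

theorem fiberSum_add_const_mul (t : ℝ) (N : ℕ) (φ ψ : ℝ → ℂ) (c : ℂ) (x η : ℝ) :
    fiberSum t N (fun ξ => φ ξ + c * ψ ξ) x η = fiberSum t N φ x η + c * fiberSum t N ψ x η := by
  simp only [fiberSum, fiber_add_const_mul, Finset.mul_sum, ← Finset.sum_add_distrib]
  exact Finset.sum_congr rfl fun j _ => by ring

theorem fourierExt_add_const_mul {t : ℝ} {φ ψ : ℝ → ℂ}
    (hφ : MemLp φ 2 (volume.restrict (Icc (-t) t))) (hψ : MemLp ψ 2 (volume.restrict (Icc (-t) t)))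
    (c z : ℂ) :
    fourierExt t (fun ξ => φ ξ + c * ψ ξ) z = fourierExt t φ z + c * fourierExt t ψ z := by
  simp only [fourierExt]
  have e : ∀ ξ : ℝ, Complex.exp (-(Complex.I * ξ * z)) * (φ ξ + c * ψ ξ)
      = Complex.exp (-(Complex.I * ξ * z)) * φ ξ + c * (Complex.exp (-(Complex.I * ξ * z)) * ψ ξ) :=
    fun ξ => by ring
  simp only [e]
  rw [integral_add (integrable_exp_mul hφ z) ((integrable_exp_mul hψ z).const_mul c),
    integral_const_mul]
  ring

/-- The shift by `2πm` does not see the integer `j` in `ξ = -t + η + j`, so all fibers contribute to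
the same Fourier mode `m` in `η`. The starting point `-t` leaves only a unimodular factor, harmless
for Parseval. -/
theorem fourierExt_add_period {t : ℝ} {φ : ℝ → ℂ} (h : MemLp φ 2 (volume.restrict (Icc (-t) t)))
    {N : ℕ} (hN : 2 * t ≤ N) (x : ℝ) (m : ℤ) :
    fourierExt t φ ((x + m * (2 * Real.pi) : ℝ) : ℂ) = ((1 / Real.sqrt (2 * Real.pi) : ℝ) : ℂ) *
      (Complex.exp (((t * (x + m * (2 * Real.pi)) : ℝ) : ℂ) * Complex.I) *
      fourierCoeffOn (zero_lt_one' ℝ)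
        (fun η => Complex.exp (((-(η * x) : ℝ) : ℂ) * Complex.I) * fiberSum t N φ x η) m) := by
  rw [fourierExt, setIntegral_Icc_eq_sum_fiber (integrable_exp_mul h _) hN,
    fourierCoeffOn_eq_integral]
  congr 1
  simp only [fiber_mul]
  rw [← intervalIntegral.integral_finsetSum]
  · simp only [sub_zero, div_one, one_smul]
    rw [← intervalIntegral.integral_const_mul]
    congr 1
    funext η
    rw [fourier_coe_apply, smul_eq_mul, fiberSum, Finset.mul_sum, Finset.mul_sum, Finset.mul_sum]
    refine Finset.sum_congr rfl fun j _ => ?_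
    rw [← mul_assoc, ← mul_assoc, ← mul_assoc, ← Complex.exp_add, ← Complex.exp_add, ← mul_assoc,
      ← Complex.exp_add]
    congr 1
    -- The exponents differ by `-2πi·jm`, coming from `e^{-ij·2πm}`.
    refine Complex.exp_eq_exp_iff_exists_int.mpr ⟨-(j * m), ?_⟩
    push_cast
    ring
  · intro j _
    refine Integrable.intervalIntegrable ?_
    have := integrable_fiber (integrable_exp_mul h ((x + m * (2 * Real.pi) : ℝ) : ℂ)) j
    exact this.congr (Filter.Eventually.of_forall fun η => fiber_mul t _ _ j η)

theorem hasSum_normSq_fourierExt {t : ℝ} {φ : ℝ → ℂ}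
    (h : MemLp φ 2 (volume.restrict (Icc (-t) t))) {N : ℕ} (hN : 2 * t ≤ N) (x : ℝ) :
    HasSum (fun m : ℤ => ‖fourierExt t φ ((x + m * (2 * Real.pi) : ℝ) : ℂ)‖ ^ 2)
      ((2 * Real.pi)⁻¹ * ∫ η in (0 : ℝ)..1, ‖fiberSum t N φ x η‖ ^ 2) := by
  have hL : MemLp (fun η : ℝ => Complex.exp (((-(η * x) : ℝ) : ℂ) * Complex.I) *
      fiberSum t N φ x η) 2 (volume.restrict (Ioc 0 1)) := by
    refine MemLp.of_le ((memLp_fiberSum h N x).restrict _) ?_ ?_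
    · refine AEStronglyMeasurable.mul (Continuous.aestronglyMeasurable (by fun_prop)) ?_
      exact ((memLp_fiberSum h N x).restrict _).aestronglyMeasurable
    · refine Filter.Eventually.of_forall fun η => ?_
      rw [norm_mul, Complex.norm_exp_ofReal_mul_I, one_mul]
  have := (hasSum_sq_fourierCoeffOn (zero_lt_one' ℝ) hL).mul_left (2 * Real.pi)⁻¹
  have e : ∫ η in (0 : ℝ)..1, ‖Complex.exp (((-(η * x) : ℝ) : ℂ) * Complex.I) *
      fiberSum t N φ x η‖ ^ 2 = ∫ η in (0 : ℝ)..1, ‖fiberSum t N φ x η‖ ^ 2 := by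
    congr 1
    funext η
    rw [norm_mul, Complex.norm_exp_ofReal_mul_I, one_mul]
  rw [e, sub_zero, inv_one, one_smul] at this
  have e2 : (fun m : ℤ => ‖fourierExt t φ ((x + m * (2 * Real.pi) : ℝ) : ℂ)‖ ^ 2) = fun m =>
      (2 * Real.pi)⁻¹ * ‖fourierCoeffOn (zero_lt_one' ℝ) (fun η =>
        Complex.exp (((-(η * x) : ℝ) : ℂ) * Complex.I) * fiberSum t N φ x η) m‖ ^ 2 := by
    funext m
    rw [fourierExt_add_period h hN, norm_mul, norm_mul, Complex.norm_exp_ofReal_mul_I, one_mul,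
      mul_pow, Complex.norm_real, Real.norm_of_nonneg (by positivity), div_pow, one_pow,
      Real.sq_sqrt (by positivity), one_div]
  rw [e2]
  exact this

/-! ### The sesquilinear form of a periodic measure -/

theorem continuous_fourierExt_ofReal {t : ℝ} {φ : ℝ → ℂ}
    (h : MemLp φ 2 (volume.restrict (Icc (-t) t))) :
    Continuous fun x : ℝ => fourierExt t φ (x : ℂ) := by
  have h1 : Integrable ((Icc (-t) t).indicator φ) :=
    (integrable_indicator_iff measurableSet_Icc).mpr (integrableOn_of_memLp h)
  have hcont : Continuous (𝓕 ((Icc (-t) t).indicator φ) : ℝ → ℂ) :=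
    VectorFourier.fourierIntegral_continuous Real.continuous_fourierChar
      (by exact continuous_inner) h1
  simp only [fourierExt_ofReal]
  exact continuous_const.mul (hcont.comp (by fun_prop))

/-- The `L²` pairing of two fibers. -/
def fiberPair (t : ℝ) (φ ψ : ℝ → ℂ) (j l : ℕ) : ℂ :=
  ∫ η in (0 : ℝ)..1, fiber t φ j η * conj (fiber t ψ l η)

theorem integrable_fiber_mul_conj {t : ℝ} {φ ψ : ℝ → ℂ}
    (hφ : MemLp φ 2 (volume.restrict (Icc (-t) t)))
    (hψ : MemLp ψ 2 (volume.restrict (Icc (-t) t))) (j l : ℕ) :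
    Integrable (fun η => fiber t φ j η * conj (fiber t ψ l η)) volume :=
  MemLp.integrable_mul (p := 2) (q := 2) (memLp_fiber hφ j) (memLp_fiber hψ l).star

theorem integral_fiberSum_mul_conj {t : ℝ} {φ ψ : ℝ → ℂ}
    (hφ : MemLp φ 2 (volume.restrict (Icc (-t) t)))
    (hψ : MemLp ψ 2 (volume.restrict (Icc (-t) t))) (N : ℕ) (x : ℝ) :
    ∫ η in (0 : ℝ)..1, fiberSum t N φ x η * conj (fiberSum t N ψ x η) =
      ∑ j ∈ Finset.range N, ∑ l ∈ Finset.range N,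
        Complex.exp (-(Complex.I * ((j - l : ℤ) : ℂ) * x)) * fiberPair t φ ψ j l := by
  have hI : ∀ j l : ℕ, IntervalIntegrable
      (fun η => Complex.exp (-(Complex.I * ((j - l : ℤ) : ℂ) * x)) *
        (fiber t φ j η * conj (fiber t ψ l η))) volume 0 1 :=
    fun j l => ((integrable_fiber_mul_conj hφ hψ j l).const_mul _).intervalIntegrable
  have e : ∀ η, fiberSum t N φ x η * conj (fiberSum t N ψ x η) =
      ∑ j ∈ Finset.range N, ∑ l ∈ Finset.range N,
        Complex.exp (-(Complex.I * ((j - l : ℤ) : ℂ) * x)) *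
        (fiber t φ j η * conj (fiber t ψ l η)) := by
    intro η
    rw [fiberSum, fiberSum, map_sum, Finset.sum_mul_sum]
    refine Finset.sum_congr rfl fun j _ => Finset.sum_congr rfl fun l _ => ?_
    rw [map_mul, ← Complex.exp_conj]
    have : Complex.exp (-(Complex.I * ((j - l : ℤ) : ℂ) * x)) =
        Complex.exp (-(Complex.I * j * x)) * Complex.exp (conj (-(Complex.I * l * x))) := by
      rw [← Complex.exp_add]
      congr 1
      simp
      ring
    rw [this]
    ring
  simp only [e]
  have hJ : ∀ j : ℕ, IntervalIntegrable (fun η => ∑ l ∈ Finset.range N,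
      Complex.exp (-(Complex.I * ((j - l : ℤ) : ℂ) * x)) *
        (fiber t φ j η * conj (fiber t ψ l η))) volume 0 1 := fun j =>
    (integrable_finsetSum _ fun l _ =>
      (integrable_fiber_mul_conj hφ hψ j l).const_mul _).intervalIntegrable
  rw [intervalIntegral.integral_finsetSum fun j _ => hJ j]
  · refine Finset.sum_congr rfl fun j _ => ?_
    rw [intervalIntegral.integral_finsetSum fun l _ => hI j l]
    refine Finset.sum_congr rfl fun l _ => ?_
    rw [intervalIntegral.integral_const_mul, fiberPair]

theorem integrableOn_exp_period {μ : Measure ℝ} [IsLocallyFiniteMeasure μ] (k : ℤ) :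
    IntegrableOn (fun x : ℝ => Complex.exp (-(Complex.I * k * x))) (Ico 0 (2 * Real.pi)) μ :=
  (Continuous.integrableOn_Icc (by fun_prop)).mono_set Ico_subset_Icc_self

theorem integral_integral_fiberSum_mul_conj {μ : Measure ℝ} [IsLocallyFiniteMeasure μ]
    {t : ℝ} {φ ψ : ℝ → ℂ}
    (hφ : MemLp φ 2 (volume.restrict (Icc (-t) t)))
    (hψ : MemLp ψ 2 (volume.restrict (Icc (-t) t))) (N : ℕ) :
    IntegrableOn (fun x => ∫ η in (0 : ℝ)..1, fiberSum t N φ x η * conj (fiberSum t N ψ x η))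
      (Ico 0 (2 * Real.pi)) μ ∧
    (2 * Real.pi : ℂ)⁻¹ * ∫ x in Ico 0 (2 * Real.pi),
        (∫ η in (0 : ℝ)..1, fiberSum t N φ x η * conj (fiberSum t N ψ x η)) ∂μ =
      ∑ j ∈ Finset.range N, ∑ l ∈ Finset.range N, moment μ (j - l) * fiberPair t φ ψ j l := by
  have hI : ∀ j l : ℕ, IntegrableOn (fun x : ℝ =>
      Complex.exp (-(Complex.I * ((j - l : ℤ) : ℂ) * x)) * fiberPair t φ ψ j l)
      (Ico 0 (2 * Real.pi)) μ := fun j l => (integrableOn_exp_period _).mul_const _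
  simp only [integral_fiberSum_mul_conj hφ hψ]
  refine ⟨integrable_finsetSum _ fun j _ => integrable_finsetSum _ fun l _ => hI j l, ?_⟩
  rw [integral_finsetSum _ fun j _ => integrable_finsetSum _ fun l _ => hI j l, Finset.mul_sum]
  refine Finset.sum_congr rfl fun j _ => ?_
  rw [integral_finsetSum _ fun l _ => hI j l, Finset.mul_sum]
  refine Finset.sum_congr rfl fun l _ => ?_
  rw [integral_mul_const, moment, one_div]
  ring

theorem memLp_fourierExt_and_integral {μ : Measure ℝ} [IsLocallyFiniteMeasure μ]
    (hper : μ.map (fun x => x + 2 * Real.pi) = μ) {t : ℝ} {φ : ℝ → ℂ}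
    (hφ : MemLp φ 2 (volume.restrict (Icc (-t) t))) {N : ℕ} (hN : 2 * t ≤ N) :
    MemLp (fun x : ℝ => fourierExt t φ (x : ℂ)) 2 μ ∧
    ((∫ x : ℝ, ‖fourierExt t φ (x : ℂ)‖ ^ 2 ∂μ : ℝ) : ℂ) =
      (2 * Real.pi : ℂ)⁻¹ * ∫ x in Ico 0 (2 * Real.pi),
        (∫ η in (0 : ℝ)..1, fiberSum t N φ x η * conj (fiberSum t N φ x η)) ∂μ := by
  have hcont := continuous_fourierExt_ofReal hφ
  have hsq : Continuous fun x : ℝ => ‖fourierExt t φ (x : ℂ)‖ ^ 2 := hcont.norm.pow 2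
  have hre : ∀ x : ℝ, ∫ η in (0 : ℝ)..1, fiberSum t N φ x η * conj (fiberSum t N φ x η) =
      ((∫ η in (0 : ℝ)..1, ‖fiberSum t N φ x η‖ ^ 2 : ℝ) : ℂ) := by
    intro x
    rw [← intervalIntegral.integral_ofReal]
    congr 1
    funext η
    rw [Complex.mul_conj']
    push_cast
    rfl
  obtain ⟨hint, -⟩ := integral_integral_fiberSum_mul_conj (μ := μ) hφ hφ N
  simp only [hre] at hint ⊢
  have hint' : IntegrableOn (fun x => (2 * Real.pi)⁻¹ *
      ∫ η in (0 : ℝ)..1, ‖fiberSum t N φ x η‖ ^ 2) (Ico 0 (2 * Real.pi)) μ := by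
    have := hint.re
    simp only [RCLike.re_to_complex, Complex.ofReal_re] at this
    exact this.const_mul _
  have hnn : ∀ x, 0 ≤ (2 * Real.pi)⁻¹ * ∫ η in (0 : ℝ)..1, ‖fiberSum t N φ x η‖ ^ 2 := fun x =>
    mul_nonneg (by positivity) (intervalIntegral.integral_nonneg zero_le_one fun _ _ => by positivity)
  -- The computation is done in `[0, ∞]`, where unfolding needs no integrability; the finite
  -- right-hand side then yields both membership in `L²(μ)` and the value of the integral.
  have key : ∫⁻ x : ℝ, ENNReal.ofReal (‖fourierExt t φ (x : ℂ)‖ ^ 2) ∂μ =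
      ENNReal.ofReal (∫ x in Ico 0 (2 * Real.pi), (2 * Real.pi)⁻¹ *
        (∫ η in (0 : ℝ)..1, ‖fiberSum t N φ x η‖ ^ 2) ∂μ) := by
    rw [ofReal_integral_eq_lintegral_ofReal hint' (Filter.Eventually.of_forall hnn),
      lintegral_eq_setLIntegral_tsum (by positivity) hper
        hsq.measurable.ennreal_ofReal]
    refine lintegral_congr fun x => ?_
    have hs := hasSum_normSq_fourierExt hφ hN x
    rw [← hs.tsum_eq, ENNReal.ofReal_tsum_of_nonneg (fun _ => by positivity) hs.summable]
  have hI : Integrable (fun x : ℝ => ‖fourierExt t φ (x : ℂ)‖ ^ 2) μ := by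
    refine ⟨hsq.aestronglyMeasurable, ?_⟩
    rw [hasFiniteIntegral_iff_ofReal (Filter.Eventually.of_forall fun _ => by positivity), key]
    exact ENNReal.ofReal_lt_top
  refine ⟨(memLp_two_iff_integrable_sq_norm hcont.aestronglyMeasurable).mpr hI, ?_⟩
  rw [integral_complex_ofReal, ← Complex.ofReal_ofNat, ← Complex.ofReal_mul, ← Complex.ofReal_inv,
    ← Complex.ofReal_mul, ← integral_const_mul]
  congr 1
  rw [integral_eq_lintegral_of_nonneg_ae (Filter.Eventually.of_forall fun _ => by positivity)
    hsq.aestronglyMeasurable, key, ENNReal.toReal_ofReal (integral_nonneg hnn)]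

theorem integral_four_combination {α : Type*} [MeasurableSpace α] {μ : Measure α}
    {F : ℂ → α → ℂ} (hF : ∀ c, Integrable (F c) μ) :
    ∫ x, (1 / 4 : ℂ) * (F 1 x - F (-1) x + Complex.I * F Complex.I x -
        Complex.I * F (-Complex.I) x) ∂μ =
      (1 / 4 : ℂ) * (∫ x, F 1 x ∂μ - ∫ x, F (-1) x ∂μ + Complex.I * ∫ x, F Complex.I x ∂μ -
        Complex.I * ∫ x, F (-Complex.I) x ∂μ) := by
  have h1 : Integrable (fun x => F 1 x - F (-1) x) μ := (hF 1).sub (hF (-1))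
  have h2 : Integrable (fun x => F 1 x - F (-1) x + Complex.I * F Complex.I x) μ :=
    h1.add ((hF _).const_mul _)
  rw [integral_const_mul, integral_sub h2 ((hF _).const_mul _),
    integral_add h1 ((hF _).const_mul _), integral_sub (hF _) (hF _), integral_const_mul,
    integral_const_mul]

/-- Parseval controls only squared norms. Weighting `‖f + c g‖²` by `c` over the fourth roots of
unity isolates `f conj(g)`: the terms with `∑ c` and `∑ c²` cancel. -/
theorem integral_mul_conj_polarization {α : Type*} [MeasurableSpace α] {μ : Measure α}
    {f g : α → ℂ} (hf : MemLp f 2 μ) (hg : MemLp g 2 μ) :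
    ∫ x, f x * conj (g x) ∂μ = (1 / 4 : ℂ) *
      (((∫ x, ‖f x + 1 * g x‖ ^ 2 ∂μ : ℝ) : ℂ) - ((∫ x, ‖f x + (-1) * g x‖ ^ 2 ∂μ : ℝ) : ℂ) +
        Complex.I * ((∫ x, ‖f x + Complex.I * g x‖ ^ 2 ∂μ : ℝ) : ℂ) -
        Complex.I * ((∫ x, ‖f x + (-Complex.I) * g x‖ ^ 2 ∂μ : ℝ) : ℂ)) := by
  have hI : ∀ c : ℂ, Integrable (fun x => ((‖f x + c * g x‖ ^ 2 : ℝ) : ℂ)) μ := fun c =>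
    ((hf.add (hg.const_mul c)).integrable_norm_pow (by norm_num)).ofReal
  simp only [← integral_complex_ofReal]
  rw [← integral_four_combination (F := fun c x => ((‖f x + c * g x‖ ^ 2 : ℝ) : ℂ)) hI]
  congr 1
  funext x
  simp only [Complex.ofReal_pow, ← Complex.mul_conj', map_add, map_mul, map_neg, map_one,
    Complex.conj_I]
  linear_combination (1 / 2 * f x * conj (g x) - 1 / 2 * g x * conj (f x)) * Complex.I_sq

/-- Both sides are polarized: the left over `μ`, the right over `η` for each fixed `x`. The four
diagonal identities then match term by term. -/
theorem integral_fourierExt_mul_conj {μ : Measure ℝ} [IsLocallyFiniteMeasure μ]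
    (hper : μ.map (fun x => x + 2 * Real.pi) = μ) {t : ℝ} {φ ψ : ℝ → ℂ}
    (hφ : MemLp φ 2 (volume.restrict (Icc (-t) t)))
    (hψ : MemLp ψ 2 (volume.restrict (Icc (-t) t))) {N : ℕ} (hN : 2 * t ≤ N) :
    ∫ x : ℝ, fourierExt t φ (x : ℂ) * conj (fourierExt t ψ (x : ℂ)) ∂μ =
      ∑ j ∈ Finset.range N, ∑ l ∈ Finset.range N, moment μ (j - l) * fiberPair t φ ψ j l := by
  have hc : ∀ c : ℂ, MemLp (fun ξ => φ ξ + c * ψ ξ) 2 (volume.restrict (Icc (-t) t)) :=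
    fun c => hφ.add (hψ.const_mul c)
  have hd := fun c => (memLp_fourierExt_and_integral hper (hc c) hN).2
  have hi := fun c => (integral_integral_fiberSum_mul_conj (μ := μ) (hc c) (hc c) N).1
  have hre : ∀ (x : ℝ) (c : ℂ), ∫ η in (0 : ℝ)..1, fiberSum t N (fun ξ => φ ξ + c * ψ ξ) x η *
      conj (fiberSum t N (fun ξ => φ ξ + c * ψ ξ) x η) =
      ((∫ η in (0 : ℝ)..1, ‖fiberSum t N φ x η + c * fiberSum t N ψ x η‖ ^ 2 : ℝ) : ℂ) := by
    intro x c
    rw [← intervalIntegral.integral_ofReal]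
    congr 1
    funext η
    rw [fiberSum_add_const_mul, Complex.mul_conj']
    push_cast
    rfl
  rw [← (integral_integral_fiberSum_mul_conj hφ hψ N).2,
    integral_mul_conj_polarization (memLp_fourierExt_and_integral hper hφ hN).1
      (memLp_fourierExt_and_integral hper hψ hN).1]
  simp only [fourierExt_add_const_mul hφ hψ, hre] at hd hi
  simp only [hd]
  have hp : ∀ x : ℝ, ∫ η in (0 : ℝ)..1, fiberSum t N φ x η * conj (fiberSum t N ψ x η) = (1 / 4 : ℂ) *
      (((∫ η in (0 : ℝ)..1, ‖fiberSum t N φ x η + 1 * fiberSum t N ψ x η‖ ^ 2 : ℝ) : ℂ) -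
        ((∫ η in (0 : ℝ)..1, ‖fiberSum t N φ x η + (-1) * fiberSum t N ψ x η‖ ^ 2 : ℝ) : ℂ) +
        Complex.I * ((∫ η in (0 : ℝ)..1,
          ‖fiberSum t N φ x η + Complex.I * fiberSum t N ψ x η‖ ^ 2 : ℝ) : ℂ) -
        Complex.I * ((∫ η in (0 : ℝ)..1,
          ‖fiberSum t N φ x η + (-Complex.I) * fiberSum t N ψ x η‖ ^ 2 : ℝ) : ℂ)) := by
    intro x
    simp only [intervalIntegral.integral_of_le zero_le_one]
    exact integral_mul_conj_polarization ((memLp_fiberSum hφ N x).restrict _)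
      ((memLp_fiberSum hψ N x).restrict _)
  simp only [hp]
  rw [integral_four_combination (F := fun c x => ((∫ η in (0 : ℝ)..1,
    ‖fiberSum t N φ x η + c * fiberSum t N ψ x η‖ ^ 2 : ℝ) : ℂ)) hi]
  ring

/-! ### Plancherel's theorem -/

theorem map_volume_add_period : (volume : Measure ℝ).map (fun x => x + 2 * Real.pi) = volume :=
  map_add_right_eq_self volume _

theorem moment_volume (k : ℤ) : moment volume k = if k = 0 then 1 else 0 := by
  have hpi : (Real.pi : ℂ) ≠ 0 := by exact_mod_cast Real.pi_ne_zero
  rw [moment, integral_Ico_eq_integral_Ioc, ← intervalIntegral.integral_of_le (by positivity)]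
  split_ifs with hk
  · subst hk
    simp
    field_simp
  · have hc : -(Complex.I * k) ≠ 0 :=
      neg_ne_zero.mpr (mul_ne_zero Complex.I_ne_zero (Int.cast_ne_zero.mpr hk))
    have e : ∀ x : ℝ, -(Complex.I * k * (x : ℂ)) = -(Complex.I * k) * x := fun x => by ring
    simp only [e]
    rw [integral_exp_mul_complex hc]
    have h1 : Complex.exp (-(Complex.I * k) * ((2 * Real.pi : ℝ) : ℂ)) = 1 := by
      rw [Complex.exp_eq_one_iff]
      exact ⟨-k, by push_cast; ring⟩
    rw [h1]
    simp

theorem integrableOn_mul_conj {t : ℝ} {φ ψ : ℝ → ℂ}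
    (hφ : MemLp φ 2 (volume.restrict (Icc (-t) t)))
    (hψ : MemLp ψ 2 (volume.restrict (Icc (-t) t))) :
    IntegrableOn (fun ξ => φ ξ * conj (ψ ξ)) (Icc (-t) t) :=
  MemLp.integrable_mul (p := 2) (q := 2) hφ hψ.star

theorem setIntegral_mul_conj_eq_sum_fiberPair {t : ℝ} {φ ψ : ℝ → ℂ}
    (hφ : MemLp φ 2 (volume.restrict (Icc (-t) t)))
    (hψ : MemLp ψ 2 (volume.restrict (Icc (-t) t))) {N : ℕ} (hN : 2 * t ≤ N) :
    ∫ ξ in Icc (-t) t, φ ξ * conj (ψ ξ) = ∑ j ∈ Finset.range N, fiberPair t φ ψ j j := by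
  rw [setIntegral_Icc_eq_sum_fiber (integrableOn_mul_conj hφ hψ) hN]
  simp only [fiber_mul_conj, fiberPair]

/-- Lebesgue measure is itself `2π`-periodic and its Toeplitz matrices are identities, so Plancherel
is a special case of the formula for periodic measures. -/
theorem integral_fourierExt_mul_conj_volume {t : ℝ} {φ ψ : ℝ → ℂ}
    (hφ : MemLp φ 2 (volume.restrict (Icc (-t) t)))
    (hψ : MemLp ψ 2 (volume.restrict (Icc (-t) t))) :
    ∫ x : ℝ, fourierExt t φ (x : ℂ) * conj (fourierExt t ψ (x : ℂ)) =
      ∫ ξ in Icc (-t) t, φ ξ * conj (ψ ξ) := by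
  obtain ⟨N, hN⟩ := exists_nat_ge (2 * t)
  rw [integral_fourierExt_mul_conj map_volume_add_period hφ hψ hN,
    setIntegral_mul_conj_eq_sum_fiberPair hφ hψ hN]
  refine Finset.sum_congr rfl fun j hj => ?_
  rw [Finset.sum_eq_single j]
  · simp [moment_volume]
  · intro l _ hl
    rw [moment_volume, if_neg (by omega), zero_mul]
  · exact fun h => absurd hj h

/-! ### Toeplitz forms -/

/-- The trigonometric polynomial `∑_j a_j e^{-ijx}`. -/
def trigPoly {N : ℕ} (a : Fin N → ℂ) (x : ℝ) : ℂ :=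
  ∑ j : Fin N, a j * Complex.exp (-(Complex.I * (j : ℕ) * x))

theorem continuous_trigPoly {N : ℕ} (a : Fin N → ℂ) : Continuous (trigPoly a) := by
  unfold trigPoly
  fun_prop

theorem toeplitzForm_eq {μ : Measure ℝ} [IsLocallyFiniteMeasure μ] {N : ℕ} (a : Fin N → ℂ) :
    ∑ j : Fin N, ∑ l : Fin N, moment μ ((j : ℤ) - (l : ℤ)) * (a j * conj (a l)) =
      (((2 * Real.pi)⁻¹ * ∫ x in Ico 0 (2 * Real.pi), ‖trigPoly a x‖ ^ 2 ∂μ : ℝ) : ℂ) := by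
  have hI : ∀ j l : Fin N, IntegrableOn (fun x : ℝ =>
      Complex.exp (-(Complex.I * (((j : ℤ) - (l : ℤ) : ℤ) : ℂ) * x)) * (a j * conj (a l)))
      (Ico 0 (2 * Real.pi)) μ := fun j l => (integrableOn_exp_period _).mul_const _
  have e : ∀ x : ℝ, ((‖trigPoly a x‖ ^ 2 : ℝ) : ℂ) = ∑ j : Fin N, ∑ l : Fin N,
      Complex.exp (-(Complex.I * (((j : ℤ) - (l : ℤ) : ℤ) : ℂ) * x)) * (a j * conj (a l)) := by
    intro x
    rw [Complex.ofReal_pow, ← Complex.mul_conj', trigPoly, map_sum, Finset.sum_mul_sum]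
    refine Finset.sum_congr rfl fun j _ => Finset.sum_congr rfl fun l _ => ?_
    have : Complex.exp (-(Complex.I * (((j : ℤ) - (l : ℤ) : ℤ) : ℂ) * x)) =
        Complex.exp (-(Complex.I * (j : ℕ) * x)) *
          Complex.exp (conj (-(Complex.I * (l : ℕ) * x))) := by
      rw [← Complex.exp_add]
      congr 1
      simp
      ring
    rw [map_mul, ← Complex.exp_conj, this]
    ring
  rw [Complex.ofReal_mul, ← integral_complex_ofReal]
  simp only [e]
  rw [integral_finsetSum _ fun j _ => integrable_finsetSum _ fun l _ => hI j l, Finset.mul_sum]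
  refine Finset.sum_congr rfl fun j _ => ?_
  rw [integral_finsetSum _ fun l _ => hI j l, Finset.mul_sum]
  refine Finset.sum_congr rfl fun l _ => ?_
  rw [integral_mul_const, moment, one_div]
  push_cast
  ring

theorem exp_injOn_period : InjOn (fun x : ℝ => Complex.exp (-(Complex.I * x))) (Ico 0 (2 * Real.pi)) := by
  intro x hx y hy hxy
  obtain ⟨n, hn⟩ := Complex.exp_eq_exp_iff_exists_int.mp hxy
  have h1 : ((y - x : ℝ) : ℂ) * Complex.I = ((n * (2 * Real.pi) : ℝ) : ℂ) * Complex.I := by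
    push_cast
    linear_combination hn
  have h2 : y - x = n * (2 * Real.pi) := by
    exact_mod_cast mul_right_cancel₀ Complex.I_ne_zero h1
  have hpi := Real.pi_pos
  obtain ⟨hx0, hx1⟩ := hx
  obtain ⟨hy0, hy1⟩ := hy
  have hn1 : (n : ℝ) < 1 := by nlinarith
  have hn2 : (-1 : ℝ) < n := by nlinarith
  have : n = 0 := by
    have h3 : n < 1 := by exact_mod_cast hn1
    have h4 : -1 < n := by exact_mod_cast hn2
    omega
  rw [this] at h2
  simp at h2
  linarith

/-- The sum is a polynomial in `e^{-ix}`, and `x ↦ e^{-ix}` is injective on a period, so infinitely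
many zeros give infinitely many roots. -/
theorem eq_zero_of_trigPoly_zeros {N : ℕ} {a : Fin N → ℂ} {s : Set ℝ} (hs : s.Infinite)
    (hsub : s ⊆ Ico 0 (2 * Real.pi)) (h : ∀ x ∈ s, trigPoly a x = 0) : a = 0 := by
  set p : Polynomial ℂ := ∑ j : Fin N, Polynomial.C (a j) * Polynomial.X ^ (j : ℕ) with hp
  have hp0 : p = 0 := by
    refine Polynomial.eq_zero_of_infinite_isRoot p ?_
    refine (hs.image (exp_injOn_period.mono hsub)).mono ?_
    rintro _ ⟨x, hx, rfl⟩
    have := h x hx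
    simp only [mem_ofPred_eq, Polynomial.IsRoot, hp, Polynomial.eval_finsetSum, Polynomial.eval_mul,
      Polynomial.eval_C, Polynomial.eval_pow, Polynomial.eval_X]
    rw [← this, trigPoly]
    refine Finset.sum_congr rfl fun j _ => ?_
    rw [← Complex.exp_nat_mul]
    congr 2
    ring
  funext i
  have := congrArg (fun q => Polynomial.coeff q (i : ℕ)) hp0
  simpa [hp, Polynomial.finsetSum_coeff, Polynomial.coeff_C_mul, Polynomial.coeff_X_pow,
    Fin.val_inj] using this

theorem MPlusCircle.eq_zero_of_integral_eq_zero {μ : Measure ℝ} (hμ : MPlusCircle μ) {N : ℕ}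
    {a : Fin N → ℂ} (h : ∫ x in Ico 0 (2 * Real.pi), ‖trigPoly a x‖ ^ 2 ∂μ = 0) : a = 0 := by
  have := hμ.locallyFinite
  have hc : Continuous fun x => ‖trigPoly a x‖ ^ 2 := (continuous_trigPoly a).norm.pow 2
  have hI : IntegrableOn (fun x => ‖trigPoly a x‖ ^ 2) (Ico 0 (2 * Real.pi)) μ :=
    hc.integrableOn_Icc.mono_set Ico_subset_Icc_self
  rw [integral_eq_zero_iff_of_nonneg (fun _ => by positivity) hI] at h
  -- The point `0` is discarded: mass near it may lie to the left of the period. Every other support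
  -- point of the period is interior to it, so a nonzero value there would be seen by the integral.
  refine eq_zero_of_trigPoly_zeros (hμ.support_infinite.sdiff (finite_singleton 0))
    (fun x hx => hx.1.2) ?_
  rintro x ⟨⟨hx, hx0, hx1⟩, hne⟩
  by_contra hxa
  have hU : IsOpen (Ioo 0 (2 * Real.pi) ∩ {y | trigPoly a y ≠ 0}) :=
    isOpen_Ioo.inter (isOpen_ne_fun (continuous_trigPoly a) continuous_const)
  have hxU : x ∈ Ioo 0 (2 * Real.pi) ∩ {y | trigPoly a y ≠ 0} :=
    ⟨⟨lt_of_le_of_ne hx0 (Ne.symm hne), hx1⟩, hxa⟩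
  refine ((Measure.mem_support_iff_forall x).mp hx _ (hU.mem_nhds hxU)).ne' ?_
  have h2 := (ae_restrict_iff' measurableSet_Ico).mp h
  refine measure_mono_null ?_ (ae_iff.mp h2)
  rintro y ⟨hy, hya⟩
  simp only [mem_ofPred_eq, Classical.not_imp]
  refine ⟨Ioo_subset_Ico_self hy, ?_⟩
  simpa using hya

/-- The constants are the minimum and maximum on the compact unit sphere, carried to all of `E` by
homogeneity. The sphere is empty when `E` is trivial, as for `N = 0`. -/
theorem exists_bounds_of_homogeneous {E : Type*} [NormedAddCommGroup E] [NormedSpace ℝ E]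
    [ProperSpace E] {q : E → ℝ} (hq : Continuous q)
    (hom : ∀ (r : ℝ) (a : E), q (r • a) = r ^ 2 * q a) (hpos : ∀ a, a ≠ 0 → 0 < q a) :
    ∃ c C : ℝ, 0 < c ∧ ∀ a, c * ‖a‖ ^ 2 ≤ q a ∧ q a ≤ C * ‖a‖ ^ 2 := by
  have hq0 : q 0 = 0 := by simpa using hom 0 0
  rcases (Metric.sphere (0 : E) 1).eq_empty_or_nonempty with he | hne
  · have : ∀ a : E, a = 0 := by
      intro a
      by_contra ha
      have : ‖a‖⁻¹ • a ∈ Metric.sphere (0 : E) 1 := by simp [norm_smul, ha]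
      simp [he] at this
    refine ⟨1, 1, one_pos, fun a => ?_⟩
    rw [this a, hq0]
    simp
  · obtain ⟨u, hu, hmin⟩ := (isCompact_sphere (0 : E) 1).exists_isMinOn hne hq.continuousOn
    obtain ⟨v, hv, hmax⟩ := (isCompact_sphere (0 : E) 1).exists_isMaxOn hne hq.continuousOn
    refine ⟨q u, q v, hpos u (by rintro rfl; simp at hu), fun a => ?_⟩
    by_cases ha : a = 0
    · simp [ha, hq0]
    have hn : ‖a‖ ≠ 0 := norm_ne_zero_iff.mpr ha
    have hmem : ‖a‖⁻¹ • a ∈ Metric.sphere (0 : E) 1 := by simp [norm_smul, ha]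
    have e : q a = ‖a‖ ^ 2 * q (‖a‖⁻¹ • a) := by
      rw [hom, inv_pow, mul_inv_cancel_left₀ (pow_ne_zero 2 hn)]
    have h1 : q u ≤ q (‖a‖⁻¹ • a) := hmin hmem
    have h2 : q (‖a‖⁻¹ • a) ≤ q v := hmax hmem
    rw [e]
    constructor <;> nlinarith [sq_nonneg ‖a‖]

theorem MPlusCircle.exists_toeplitzForm_bounds {μ : Measure ℝ} (hμ : MPlusCircle μ) (N : ℕ) :
    ∃ c C : ℝ, 0 < c ∧ ∀ a : Fin N → ℂ,
      c * ∑ j, ‖a j‖ ^ 2 ≤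
        (∑ j : Fin N, ∑ l : Fin N, moment μ ((j : ℤ) - (l : ℤ)) * (a j * conj (a l))).re ∧
      (∑ j : Fin N, ∑ l : Fin N, moment μ ((j : ℤ) - (l : ℤ)) * (a j * conj (a l))).re ≤
        C * ∑ j, ‖a j‖ ^ 2 := by
  have := hμ.locallyFinite
  -- The Euclidean norm is used because its square is `∑ ‖a j‖²`; the default norm on `Fin N → ℂ` is
  -- the supremum.
  have hom : ∀ (r : ℝ) (a : EuclideanSpace ℂ (Fin N)),
      (∑ j : Fin N, ∑ l : Fin N,
        moment μ ((j : ℤ) - (l : ℤ)) * ((r • a) j * conj ((r • a) l))).re =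
      r ^ 2 * (∑ j : Fin N, ∑ l : Fin N, moment μ ((j : ℤ) - (l : ℤ)) * (a j * conj (a l))).re := by
    intro r a
    rw [← Complex.re_ofReal_mul, Finset.mul_sum]
    congr 1
    refine Finset.sum_congr rfl fun j _ => ?_
    rw [Finset.mul_sum]
    refine Finset.sum_congr rfl fun l _ => ?_
    simp
    ring
  have hpos : ∀ a : EuclideanSpace ℂ (Fin N), a ≠ 0 →
      0 < (∑ j : Fin N, ∑ l : Fin N, moment μ ((j : ℤ) - (l : ℤ)) * (a j * conj (a l))).re := by
    intro a ha
    rw [toeplitzForm_eq a, Complex.ofReal_re]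
    refine mul_pos (by positivity) (lt_of_le_of_ne (integral_nonneg fun _ => by positivity) ?_)
    intro h0
    refine ha ?_
    have := hμ.eq_zero_of_integral_eq_zero h0.symm
    ext j
    exact congrFun this j
  obtain ⟨c, C, hc, h⟩ := exists_bounds_of_homogeneous (by fun_prop) hom hpos
  refine ⟨c, C, hc, fun a => ?_⟩
  have := h (WithLp.toLp 2 a)
  rwa [EuclideanSpace.norm_sq_eq] at this

/-- A vector in the kernel makes the Toeplitz form vanish, against the strict lower bound. -/
theorem MPlusCircle.isUnit_toeplitzMatrix {μ : Measure ℝ} (hμ : MPlusCircle μ) (n : ℕ) :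
    IsUnit (toeplitzMatrix μ n) := by
  rw [Matrix.isUnit_iff_isUnit_det, isUnit_iff_ne_zero]
  intro hdet
  obtain ⟨a, ha, h0⟩ := Matrix.exists_mulVec_eq_zero_iff.mpr hdet
  obtain ⟨c, C, hc, h⟩ := hμ.exists_toeplitzForm_bounds n
  have hform : ∑ j : Fin n, ∑ l : Fin n, moment μ ((j : ℤ) - (l : ℤ)) * (a j * conj (a l)) = 0 := by
    rw [Finset.sum_comm]
    refine Finset.sum_eq_zero fun l _ => ?_
    have := congrFun h0 l
    simp only [Matrix.mulVec, dotProduct, toeplitzMatrix, Matrix.of_apply, Pi.zero_apply] at this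
    rw [← zero_mul (conj (a l)), ← this, Finset.sum_mul]
    exact Finset.sum_congr rfl fun j _ => by ring
  have h1 := (h a).1
  rw [hform, Complex.zero_re] at h1
  refine ha (funext fun j => ?_)
  have h2 : ∑ j, ‖a j‖ ^ 2 = 0 :=
    le_antisymm (by nlinarith) (Finset.sum_nonneg fun _ _ => by positivity)
  have h3 := (Finset.sum_eq_zero_iff_of_nonneg fun _ _ => by positivity).mp h2 j (Finset.mem_univ j)
  simpa using h3

theorem conj_moment (μ : Measure ℝ) (k : ℤ) : conj (moment μ k) = moment μ (-k) := by
  rw [moment, moment, map_mul, ← integral_conj]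
  congr 1
  · simp [Complex.conj_ofNat]
  · congr 1
    funext x
    rw [← Complex.exp_conj]
    simp

theorem isHermitian_toeplitzMatrix (μ : Measure ℝ) (n : ℕ) : (toeplitzMatrix μ n).IsHermitian := by
  ext j k
  simp [toeplitzMatrix, Matrix.conjTranspose_apply, conj_moment]

/-- Conjugation amounts to transposition, which permutes the entries. Applied to `Γ_n⁻¹`, this makes
the numbers `h_n` real. -/
theorem conj_entrySum {n : ℕ} {A : Matrix (Fin n) (Fin n) ℂ} (hA : A.IsHermitian) :
    conj (entrySum A) = entrySum A := by
  simp only [entrySum, map_sum]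
  rw [Finset.sum_comm]
  exact Finset.sum_congr rfl fun j _ => Finset.sum_congr rfl fun k _ => hA.apply j k

/-! ### Completeness of the Paley–Wiener space -/

theorem fourierExt_congr_ae {t : ℝ} {φ ψ : ℝ → ℂ} (h : φ =ᵐ[volume.restrict (Icc (-t) t)] ψ) :
    fourierExt t φ = fourierExt t ψ := by
  funext z
  simp only [fourierExt]
  congr 1
  refine integral_congr_ae ?_
  filter_upwards [h] with ξ hξ
  rw [hξ]

/-- The element of `PW_t` with density `φ`. -/
def PaleyWiener.ofDensity {t : ℝ} (φ : ℝ → ℂ) (h : MemLp φ 2 (volume.restrict (Icc (-t) t))) :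
    PaleyWiener t := ⟨fourierExt t φ, φ, h, rfl⟩

@[simp] theorem PaleyWiener.ofDensity_apply {t : ℝ} {φ : ℝ → ℂ}
    (h : MemLp φ 2 (volume.restrict (Icc (-t) t))) (z : ℂ) :
    ofDensity φ h z = fourierExt t φ z := rfl

theorem PaleyWiener.exists_density {t : ℝ} (f : PaleyWiener t) :
    ∃ (φ : ℝ → ℂ) (h : MemLp φ 2 (volume.restrict (Icc (-t) t))), f = ofDensity φ h := by
  obtain ⟨_, φ, hφ, rfl⟩ := f
  exact ⟨φ, hφ, rfl⟩

theorem PaleyWiener.inner_ofDensity {t : ℝ} {φ ψ : ℝ → ℂ}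
    (hφ : MemLp φ 2 (volume.restrict (Icc (-t) t)))
    (hψ : MemLp ψ 2 (volume.restrict (Icc (-t) t))) :
    ⟪ofDensity ψ hψ, ofDensity φ hφ⟫_ℂ = ∫ ξ in Icc (-t) t, φ ξ * conj (ψ ξ) := by
  rw [inner_def, ← integral_fourierExt_mul_conj_volume hφ hψ]
  simp only [ofDensity_apply, mul_comm]

/-- The unitary map from `L²[-t, t]` onto `PW_t`. -/
def paleyWienerIsometry (t : ℝ) :
    Lp ℂ 2 ((volume : Measure ℝ).restrict (Icc (-t) t)) →ₗᵢ[ℂ] PaleyWiener t where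
  toFun φ := PaleyWiener.ofDensity φ (Lp.memLp φ)
  map_add' φ ψ := by
    refine PaleyWiener.ext fun z => ?_
    have h := fourierExt_add_const_mul (Lp.memLp φ) (Lp.memLp ψ) 1 z
    simp only [one_mul] at h
    rw [PaleyWiener.add_apply, PaleyWiener.ofDensity_apply, PaleyWiener.ofDensity_apply,
      PaleyWiener.ofDensity_apply, ← h, fourierExt_congr_ae (Lp.coeFn_add φ ψ)]
    rfl
  map_smul' c φ := by
    refine PaleyWiener.ext fun z => ?_
    have h := fourierExt_add_const_mul (MemLp.zero (ε := ℂ)) (Lp.memLp φ) c z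
    rw [RingHom.id_apply, PaleyWiener.smul_apply, PaleyWiener.ofDensity_apply,
      PaleyWiener.ofDensity_apply, fourierExt_congr_ae (Lp.coeFn_smul c φ)]
    simpa [fourierExt, mul_assoc] using h
  norm_map' φ := by
    change ‖PaleyWiener.ofDensity φ (Lp.memLp φ)‖ = ‖φ‖
    rw [← sq_eq_sq₀ (norm_nonneg _) (norm_nonneg _), ← inner_self_eq_norm_sq (𝕜 := ℂ),
      ← inner_self_eq_norm_sq (𝕜 := ℂ), PaleyWiener.inner_ofDensity, L2.inner_def]
    rfl

/-- Completeness is transported from `L²[-t, t]`; it is needed for adjoints and for inverting a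
coercive operator. -/
instance (t : ℝ) : CompleteSpace (PaleyWiener t) := by
  have hs : Function.Surjective (paleyWienerIsometry t) := by
    intro f
    obtain ⟨φ, hφ, rfl⟩ := f.exists_density
    exact ⟨hφ.toLp φ, PaleyWiener.ext fun z => congrFun (fourierExt_congr_ae hφ.coeFn_toLp) z⟩
  exact ((paleyWienerIsometry t).isometry.isUniformEmbedding.completeSpace_congr hs).mp
    inferInstance

/-! ### The truncated Toeplitz operator -/

theorem PaleyWiener.memLp_measure {μ : Measure ℝ} (hμ : MPlusCircle μ) {t : ℝ}
    (f : PaleyWiener t) : MemLp (fun x : ℝ => f (x : ℂ)) 2 μ := by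
  obtain ⟨φ, hφ, rfl⟩ := f.exists_density
  obtain ⟨N, hN⟩ := exists_nat_ge (2 * t)
  have := hμ.locallyFinite
  exact (memLp_fourierExt_and_integral hμ.periodic hφ hN).1

theorem sum_sum_mul_fiberPair_eq_integral {t : ℝ} {φ ψ : ℝ → ℂ}
    (hφ : MemLp φ 2 (volume.restrict (Icc (-t) t)))
    (hψ : MemLp ψ 2 (volume.restrict (Icc (-t) t))) (N : ℕ) (m : ℤ → ℂ) :
    Integrable (fun η : ℝ => ∑ j : Fin N, ∑ l : Fin N,
      m ((j : ℤ) - (l : ℤ)) * (fiber t φ j η * conj (fiber t ψ l η))) ∧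
    ∑ j ∈ Finset.range N, ∑ l ∈ Finset.range N, m (j - l) * fiberPair t φ ψ j l =
      ∫ η in (0 : ℝ)..1, ∑ j : Fin N, ∑ l : Fin N,
        m ((j : ℤ) - (l : ℤ)) * (fiber t φ j η * conj (fiber t ψ l η)) := by
  have hI : ∀ j l : Fin N, Integrable (fun η : ℝ =>
      m ((j : ℤ) - (l : ℤ)) * (fiber t φ j η * conj (fiber t ψ l η))) := fun j l =>
    (integrable_fiber_mul_conj hφ hψ j l).const_mul _
  have hJ : ∀ j : Fin N, Integrable (fun η : ℝ => ∑ l : Fin N,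
      m ((j : ℤ) - (l : ℤ)) * (fiber t φ j η * conj (fiber t ψ l η))) := fun j =>
    integrable_finsetSum _ fun l _ => hI j l
  refine ⟨integrable_finsetSum _ fun j _ => hJ j, ?_⟩
  rw [intervalIntegral.integral_finsetSum fun j _ => (hJ j).intervalIntegrable, Finset.sum_range]
  refine Finset.sum_congr rfl fun j _ => ?_
  rw [intervalIntegral.integral_finsetSum fun l _ => (hI j l).intervalIntegrable, Finset.sum_range]
  refine Finset.sum_congr rfl fun l _ => ?_
  rw [intervalIntegral.integral_const_mul, fiberPair]

theorem PaleyWiener.norm_sq_ofDensity {t : ℝ} {φ : ℝ → ℂ}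
    (hφ : MemLp φ 2 (volume.restrict (Icc (-t) t))) {N : ℕ} (hN : 2 * t ≤ N) :
    ‖ofDensity φ hφ‖ ^ 2 = ∫ η in (0 : ℝ)..1, ∑ j : Fin N, ‖fiber t φ j η‖ ^ 2 := by
  rw [← inner_self_eq_norm_sq (𝕜 := ℂ), inner_ofDensity,
    setIntegral_mul_conj_eq_sum_fiberPair hφ hφ hN, Finset.sum_range,
    intervalIntegral.integral_finsetSum fun (j : Fin N) _ =>
      ((memLp_fiber hφ j).integrable_norm_pow (by norm_num)).intervalIntegrable, map_sum]
  refine Finset.sum_congr rfl fun j _ => ?_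
  have e : ∀ η, fiber t φ j η * conj (fiber t φ j η) = ((‖fiber t φ j η‖ ^ 2 : ℝ) : ℂ) := by
    intro η
    rw [Complex.mul_conj']
    push_cast
    rfl
  simp only [fiberPair, e]
  rw [intervalIntegral.integral_ofReal, RCLike.re_to_complex, Complex.ofReal_re]

/-- The matrix bounds hold for the vector of fibers at each `η` and are integrated. One size `N ≥
2t` serves all `η`, since shorter fibers are padded by zeros. -/
theorem MPlusCircle.exists_integral_bounds {μ : Measure ℝ} (hμ : MPlusCircle μ) (t : ℝ) :
    ∃ c C : ℝ, 0 < c ∧ ∀ f : PaleyWiener t,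
      c * ‖f‖ ^ 2 ≤ (∫ x : ℝ, f (x : ℂ) * conj (f (x : ℂ)) ∂μ).re ∧
      (∫ x : ℝ, f (x : ℂ) * conj (f (x : ℂ)) ∂μ).re ≤ C * ‖f‖ ^ 2 := by
  obtain ⟨N, hN⟩ := exists_nat_ge (2 * t)
  have := hμ.locallyFinite
  obtain ⟨c, C, hc, h⟩ := hμ.exists_toeplitzForm_bounds N
  refine ⟨c, C, hc, fun f => ?_⟩
  obtain ⟨φ, hφ, rfl⟩ := f.exists_density
  obtain ⟨hI, hs⟩ := sum_sum_mul_fiberPair_eq_integral hφ hφ N (moment μ)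
  have hn : IntervalIntegrable (fun η => ∑ j : Fin N, ‖fiber t φ j η‖ ^ 2) volume 0 1 :=
    (integrable_finsetSum _ fun (j : Fin N) _ =>
      (memLp_fiber hφ j).integrable_norm_pow (by norm_num)).intervalIntegrable
  simp only [PaleyWiener.ofDensity_apply]
  rw [integral_fourierExt_mul_conj hμ.periodic hφ hφ hN, hs, PaleyWiener.norm_sq_ofDensity hφ hN,
    intervalIntegral.integral_of_le (f := fun η => ∑ j : Fin N, ∑ l : Fin N, _) zero_le_one,
    ← RCLike.re_to_complex, ← integral_re hI.integrableOn,
    ← intervalIntegral.integral_of_le zero_le_one, ← intervalIntegral.integral_const_mul,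
    ← intervalIntegral.integral_const_mul]
  exact ⟨intervalIntegral.integral_mono_on zero_le_one (hn.const_mul _) hI.re.intervalIntegrable
      fun η _ => (h fun j => fiber t φ j η).1,
    intervalIntegral.integral_mono_on zero_le_one hI.re.intervalIntegrable (hn.const_mul _)
      fun η _ => (h fun j => fiber t φ j η).2⟩

/-- The inclusion of `PW_t` into `L²(μ)`, as a linear map. -/
def MPlusCircle.embedding {μ : Measure ℝ} (hμ : MPlusCircle μ) (t : ℝ) :
    PaleyWiener t →ₗ[ℂ] Lp ℂ 2 μ where
  toFun f := (f.memLp_measure hμ).toLp _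
  map_add' f g := (f.memLp_measure hμ).toLp_add (g.memLp_measure hμ)
  map_smul' c f := (f.memLp_measure hμ).toLp_const_smul c

theorem MPlusCircle.inner_embedding {μ : Measure ℝ} (hμ : MPlusCircle μ) {t : ℝ}
    (f g : PaleyWiener t) :
    ⟪hμ.embedding t g, hμ.embedding t f⟫_ℂ = ∫ x : ℝ, f (x : ℂ) * conj (g (x : ℂ)) ∂μ := by
  rw [L2.inner_def]
  refine integral_congr_ae ?_
  filter_upwards [(f.memLp_measure hμ).coeFn_toLp, (g.memLp_measure hμ).coeFn_toLp] with x hf hg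
  change inner ℂ (((g.memLp_measure hμ).toLp _ : ℝ → ℂ) x)
    (((f.memLp_measure hμ).toLp _ : ℝ → ℂ) x) = _
  rw [hf, hg, RCLike.inner_apply]

/-- With `J` the inclusion of `PW_t` into `L²(μ)`, the operator is `J* J`. The upper bound makes `J`
bounded and the lower bound makes `J* J` coercive, hence invertible. -/
theorem MPlusCircle.exists_isTruncatedToeplitz {μ : Measure ℝ} (hμ : MPlusCircle μ) (t : ℝ) :
    ∃ L, IsTruncatedToeplitz μ t L ∧ IsUnit L := by
  obtain ⟨c, C, hc, h⟩ := hμ.exists_integral_bounds t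
  have hJ : ∀ f : PaleyWiener t, ‖hμ.embedding t f‖ ^ 2 =
      (∫ x : ℝ, f (x : ℂ) * conj (f (x : ℂ)) ∂μ).re := fun f => by
    rw [← inner_self_eq_norm_sq (𝕜 := ℂ), hμ.inner_embedding]
    rfl
  set J : PaleyWiener t →L[ℂ] Lp ℂ 2 μ := (hμ.embedding t).mkContinuous (Real.sqrt C) (fun f => by
    rcases eq_or_ne f 0 with rfl | hf
    · simp
    have hf2 : 0 < ‖f‖ ^ 2 := by positivity
    -- Nothing was said about the sign of `C`; any nonzero `f` forces `c ≤ C`.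
    have h0 : 0 ≤ C := le_trans hc.le (le_of_mul_le_mul_right ((h f).1.trans (h f).2) hf2)
    rw [← sq_le_sq₀ (norm_nonneg _) (by positivity), mul_pow, Real.sq_sqrt h0, hJ]
    exact (h f).2)
  have hin : ∀ f g : PaleyWiener t, ⟪g, (ContinuousLinearMap.adjoint J ∘L J) f⟫_ℂ =
      ∫ x : ℝ, f (x : ℂ) * conj (g (x : ℂ)) ∂μ := fun f g => by
    rw [ContinuousLinearMap.comp_apply, ContinuousLinearMap.adjoint_inner_right]
    exact hμ.inner_embedding f g
  refine ⟨ContinuousLinearMap.adjoint J ∘L J, ⟨fun f => f.memLp_measure hμ, hin⟩, ?_⟩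
  refine ContinuousLinearMap.isUnit_of_forall_le_norm_inner_map _ (c := ⟨c, hc.le⟩) hc fun f => ?_
  rw [norm_inner_symm, hin, mul_comm]
  exact (h f).1.trans (Complex.re_le_norm _)

/-! ### The solution of the Toeplitz system with constant right-hand side -/

/-- The solution `Γ_N⁻¹ (1, …, 1)`, extended by zero to all indices. -/
def toeplitzSolution (μ : Measure ℝ) (N j : ℕ) : ℂ :=
  if h : j < N then ((toeplitzMatrix μ N)⁻¹.mulVec 1) ⟨j, h⟩ else 0

theorem toeplitzSolution_of_le (μ : Measure ℝ) {N j : ℕ} (h : N ≤ j) :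
    toeplitzSolution μ N j = 0 := dif_neg (not_lt.mpr h)

theorem sum_toeplitzSolution (μ : Measure ℝ) (N : ℕ) :
    ∑ j ∈ Finset.range N, toeplitzSolution μ N j = entrySum (toeplitzMatrix μ N)⁻¹ := by
  rw [Finset.sum_range, entrySum]
  refine Finset.sum_congr rfl fun j _ => ?_
  simp [toeplitzSolution, Matrix.mulVec, dotProduct]

theorem sum_moment_mul_toeplitzSolution {μ : Measure ℝ} {N l : ℕ}
    (hu : IsUnit (toeplitzMatrix μ N)) (hl : l < N) :
    ∑ j ∈ Finset.range N, moment μ (j - l) * toeplitzSolution μ N j = 1 := by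
  have h : (toeplitzMatrix μ N).mulVec ((toeplitzMatrix μ N)⁻¹.mulVec 1) = 1 := by
    rw [Matrix.mulVec_mulVec, Matrix.mul_nonsing_inv _ ((Matrix.isUnit_iff_isUnit_det _).mp hu),
      Matrix.one_mulVec]
  have h1 := congrFun h ⟨l, hl⟩
  rw [Finset.sum_range]
  simpa only [toeplitzSolution, Fin.is_lt, dite_true, Matrix.mulVec, dotProduct, toeplitzMatrix,
    Matrix.of_apply, Pi.one_apply] using h1

/-- Extension by zero lets both fiber sizes share the index range `n + 1`. -/
theorem sum_toeplitzSolution_succ (μ : Measure ℝ) {n N : ℕ} (h : N = n + 1 ∨ N = n) :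
    ∑ j ∈ Finset.range (n + 1), toeplitzSolution μ N j = entrySum (toeplitzMatrix μ N)⁻¹ := by
  rw [← sum_toeplitzSolution]
  rcases h with rfl | rfl
  · rfl
  · rw [Finset.sum_range_succ, toeplitzSolution_of_le μ le_rfl, add_zero]

theorem sum_moment_mul_toeplitzSolution_succ {μ : Measure ℝ} {n N l : ℕ} (h : N = n + 1 ∨ N = n)
    (hu : IsUnit (toeplitzMatrix μ N)) (hl : l < N) :
    ∑ j ∈ Finset.range (n + 1), moment μ (j - l) * toeplitzSolution μ N j = 1 := by
  rw [← sum_moment_mul_toeplitzSolution hu hl]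
  rcases h with rfl | rfl
  · rfl
  · rw [Finset.sum_range_succ, toeplitzSolution_of_le μ le_rfl, mul_zero, add_zero]

/-! ### The density of `k_t` -/

/-- The number of points of `η + ℤ` in `[0, 2t]`, for `0 ≤ η < 1` and `n = ⌊2t⌋`. -/
def fiberSize (t : ℝ) (n : ℕ) (η : ℝ) : ℕ := if η ≤ 2 * t - n then n + 1 else n

theorem fiberSize_eq (t : ℝ) (n : ℕ) (η : ℝ) : fiberSize t n η = n + 1 ∨ fiberSize t n η = n := by
  unfold fiberSize
  split_ifs <;> simp

/-- The density of `k_t` on `[-t, t]`, for `n = ⌊2t⌋`. -/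
def kernelDensity (μ : Measure ℝ) (t : ℝ) (n : ℕ) (ξ : ℝ) : ℂ :=
  ((1 / Real.sqrt (2 * Real.pi) : ℝ) : ℂ) *
    toeplitzSolution μ (fiberSize t n (Int.fract (ξ + t))) ⌊ξ + t⌋.toNat

theorem measurable_kernelDensity (μ : Measure ℝ) (t : ℝ) (n : ℕ) :
    Measurable (kernelDensity μ t n) := by
  have h1 : Measurable fun ξ : ℝ => fiberSize t n (Int.fract (ξ + t)) :=
    Measurable.ite (measurableSet_le (by fun_prop) measurable_const) measurable_const
      measurable_const
  have h2 : Measurable fun ξ : ℝ => ⌊ξ + t⌋.toNat :=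
    (measurable_from_top (f := Int.toNat)).comp (Int.measurable_floor.comp (by fun_prop))
  -- The density depends on `ξ` only through a pair of natural numbers, where every function is
  -- measurable.
  exact ((measurable_of_countable fun p : ℕ × ℕ => toeplitzSolution μ p.1 p.2).comp
    (h1.prodMk h2)).const_mul _

theorem norm_toeplitzSolution_le (μ : Measure ℝ) (N j : ℕ) :
    ‖toeplitzSolution μ N j‖ ≤ ∑ i ∈ Finset.range N, ‖toeplitzSolution μ N i‖ := by
  by_cases h : j < N
  · exact Finset.single_le_sum (f := fun i => ‖toeplitzSolution μ N i‖)
      (fun _ _ => norm_nonneg _) (Finset.mem_range.mpr h)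
  · rw [toeplitzSolution_of_le μ (not_lt.mp h), norm_zero]
    exact Finset.sum_nonneg fun _ _ => norm_nonneg _

theorem memLp_kernelDensity (μ : Measure ℝ) (t : ℝ) (n : ℕ) :
    MemLp (kernelDensity μ t n) 2 (volume.restrict (Icc (-t) t)) := by
  refine MemLp.const_mul (MemLp.of_bound (f := fun ξ => toeplitzSolution μ
    (fiberSize t n (Int.fract (ξ + t))) ⌊ξ + t⌋.toNat) ?_
    (∑ i ∈ Finset.range (n + 1), ‖toeplitzSolution μ (n + 1) i‖ +
      ∑ i ∈ Finset.range n, ‖toeplitzSolution μ n i‖) (Filter.Eventually.of_forall fun ξ => ?_)) _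
  · have := ((measurable_kernelDensity μ t n).const_mul
      (((1 / Real.sqrt (2 * Real.pi) : ℝ) : ℂ))⁻¹).aestronglyMeasurable
      (μ := volume.restrict (Icc (-t) t))
    refine this.congr (Filter.Eventually.of_forall fun ξ => inv_mul_cancel_left₀ ?_ _)
    have : (1 / Real.sqrt (2 * Real.pi) : ℝ) ≠ 0 := by positivity
    exact_mod_cast this
  · have h1 : 0 ≤ ∑ i ∈ Finset.range (n + 1), ‖toeplitzSolution μ (n + 1) i‖ :=
      Finset.sum_nonneg fun _ _ => norm_nonneg _
    have h2 : 0 ≤ ∑ i ∈ Finset.range n, ‖toeplitzSolution μ n i‖ :=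
      Finset.sum_nonneg fun _ _ => norm_nonneg _
    refine (norm_toeplitzSolution_le μ _ _).trans ?_
    rcases fiberSize_eq t n (Int.fract (ξ + t)) with h | h <;> rw [h] <;> linarith

theorem fiber_eq_zero_of_fiberSize_le {t : ℝ} {n l : ℕ} (ψ : ℝ → ℂ)
    (hn : 2 * t < n + 1) {η : ℝ} (h0 : 0 ≤ η) (hl : fiberSize t n η ≤ l) : fiber t ψ l η = 0 := by
  refine indicator_of_notMem ?_ _
  rintro ⟨-, h⟩
  unfold fiberSize at hl
  split_ifs at hl with hη
  · have : (n : ℝ) + 1 ≤ l := by exact_mod_cast hl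
    linarith
  · have : (n : ℝ) ≤ l := by exact_mod_cast hl
    linarith

theorem mem_Icc_of_lt_fiberSize {t : ℝ} {n l : ℕ} (hn : n ≤ 2 * t) {η : ℝ} (h0 : 0 ≤ η)
    (h1 : η < 1) (hl : l < fiberSize t n η) : -t + η + l ∈ Icc (-t) t := by
  refine ⟨by linarith [(Nat.cast_nonneg l : (0 : ℝ) ≤ l)], ?_⟩
  unfold fiberSize at hl
  split_ifs at hl with hη
  · have : (l : ℝ) ≤ n := by exact_mod_cast Nat.lt_succ_iff.mp hl
    linarith
  · have : (l : ℝ) + 1 ≤ n := by exact_mod_cast hl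
    linarith

theorem fiber_kernelDensity (μ : Measure ℝ) {t : ℝ} {n : ℕ} (hn : n ≤ 2 * t) (hn' : 2 * t < n + 1)
    {η : ℝ} (h0 : 0 ≤ η) (h1 : η < 1) (j : ℕ) :
    fiber t (kernelDensity μ t n) j η = ((1 / Real.sqrt (2 * Real.pi) : ℝ) : ℂ) *
      toeplitzSolution μ (fiberSize t n η) j := by
  rcases lt_or_ge j (fiberSize t n η) with hj | hj
  · rw [fiber, indicator_of_mem (mem_Icc_of_lt_fiberSize hn h0 h1 hj), kernelDensity]
    have e : -t + η + j + t = η + (j : ℤ) := by push_cast; ring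
    rw [e, Int.fract_add_intCast, Int.floor_add_intCast, Int.fract_eq_self.mpr ⟨h0, h1⟩,
      Int.floor_eq_zero_iff.mpr ⟨h0, h1⟩, zero_add, Int.toNat_natCast]
  · rw [fiber_eq_zero_of_fiberSize_le _ hn' h0 hj, toeplitzSolution_of_le μ hj, mul_zero]

/-- This is the weak form of `L_{μ,t} k_t = sin(tz)/(πz)`. For fixed `η` and `l`, the sum over `j`
is row `l` of the system `Γ_N a = (1, …, 1)`; when `l ≥ N`, the fiber of `ψ` vanishes and the row is
not needed. -/
theorem MPlusCircle.integral_kernelDensity_mul_conj {μ : Measure ℝ} (hμ : MPlusCircle μ) {t : ℝ}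
    {n : ℕ} (hn : n ≤ 2 * t) (hn' : 2 * t < n + 1) {ψ : ℝ → ℂ}
    (hψ : MemLp ψ 2 (volume.restrict (Icc (-t) t))) :
    ∫ x : ℝ, fourierExt t (kernelDensity μ t n) (x : ℂ) * conj (fourierExt t ψ (x : ℂ)) ∂μ =
      ∫ ξ in Icc (-t) t, ((1 / Real.sqrt (2 * Real.pi) : ℝ) : ℂ) * conj (ψ ξ) := by
  have := hμ.locallyFinite
  have hN : 2 * t ≤ ((n + 1 : ℕ) : ℝ) := by push_cast; exact hn'.le
  have hc : MemLp (fun _ : ℝ => ((1 / Real.sqrt (2 * Real.pi) : ℝ) : ℂ)) 2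
    (volume.restrict (Icc (-t) t)) := memLp_const _
  have hD := memLp_kernelDensity μ t n
  rw [integral_fourierExt_mul_conj hμ.periodic hD hψ hN,
    setIntegral_mul_conj_eq_sum_fiberPair hc hψ hN, Finset.sum_comm]
  refine Finset.sum_congr rfl fun l _ => ?_
  simp only [fiberPair, ← intervalIntegral.integral_const_mul]
  rw [← intervalIntegral.integral_finsetSum fun j _ =>
    ((integrable_fiber_mul_conj hD hψ j l).const_mul _).intervalIntegrable]
  -- Endpoints are dropped because the formula for the fibers of the density requires `η < 1`.
  simp only [intervalIntegral.integral_of_le zero_le_one, integral_Ioc_eq_integral_Ioo]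
  refine setIntegral_congr_fun measurableSet_Ioo fun η ⟨h0, h1⟩ => ?_
  simp only [fiber_kernelDensity μ hn hn' h0.le h1]
  rcases lt_or_ge l (fiberSize t n η) with hl | hl
  · have hs := sum_moment_mul_toeplitzSolution_succ (fiberSize_eq t n η)
      (hμ.isUnit_toeplitzMatrix _) hl
    have hconst : fiber t (fun _ => ((1 / Real.sqrt (2 * Real.pi) : ℝ) : ℂ)) l η =
        ((1 / Real.sqrt (2 * Real.pi) : ℝ) : ℂ) :=
      indicator_of_mem (mem_Icc_of_lt_fiberSize hn h0.le h1 hl) _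
    rw [hconst, ← one_mul (_ * conj (fiber t ψ l η)), ← hs, Finset.sum_mul]
    exact Finset.sum_congr rfl fun j _ => by ring
  · simp [fiber_eq_zero_of_fiberSize_le ψ hn' h0.le hl]

theorem MPlusCircle.isTruncatedToeplitz {μ : Measure ℝ} (hμ : MPlusCircle μ) (t : ℝ) :
    IsTruncatedToeplitz μ t (truncatedToeplitz μ t) ∧ IsUnit (truncatedToeplitz μ t) := by
  obtain ⟨L, hL, hu⟩ := hμ.exists_isTruncatedToeplitz t
  rw [hL.eq]
  exact ⟨hL, hu⟩

theorem MPlusCircle.kernelAtZero_eq {μ : Measure ℝ} (hμ : MPlusCircle μ) {t : ℝ}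
    {n : ℕ} (hn : n ≤ 2 * t) (hn' : 2 * t < n + 1) :
    kernelAtZero μ t = PaleyWiener.ofDensity (kernelDensity μ t n) (memLp_kernelDensity μ t n) := by
  obtain ⟨hL, hu⟩ := hμ.isTruncatedToeplitz t
  have h : truncatedToeplitz μ t (PaleyWiener.ofDensity _ (memLp_kernelDensity μ t n)) =
      sincKernel t := by
    refine ext_inner_left ℂ fun g => ?_
    obtain ⟨ψ, hψ, rfl⟩ := g.exists_density
    rw [hL.inner_eq]
    exact (hμ.integral_kernelDensity_mul_conj hn hn' hψ).trans
      (PaleyWiener.inner_ofDensity (memLp_const _) hψ).symm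
  rw [kernelAtZero, ← h, ← mul_apply_eq_comp, Ring.inverse_mul_cancel _ hu]
  rfl

/-- At `z = 0` the exponential is `1`, so `k_t(0)` is the integral of the density up to the factor
`(2π)^{-1/2}`. Summing over a fiber gives `Σ[Γ_N⁻¹]`, a step function of `η` with its jump at `2t -
n`. -/
theorem MPlusCircle.kernelAtZero_apply_zero {μ : Measure ℝ} (hμ : MPlusCircle μ) {t : ℝ}
    {n : ℕ} (hn : n ≤ 2 * t) (hn' : 2 * t < n + 1) :
    kernelAtZero μ t 0 = (2 * Real.pi : ℂ)⁻¹ *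
      ((2 * t - n) * entrySum (toeplitzMatrix μ (n + 1))⁻¹ +
        (n + 1 - 2 * t) * entrySum (toeplitzMatrix μ n)⁻¹) := by
  have hN : 2 * t ≤ ((n + 1 : ℕ) : ℝ) := by push_cast; exact hn'.le
  have hD := integrableOn_of_memLp (memLp_kernelDensity μ t n)
  have h2 : ((1 / Real.sqrt (2 * Real.pi) : ℝ) : ℂ) * ((1 / Real.sqrt (2 * Real.pi) : ℝ) : ℂ)
      = (2 * Real.pi : ℂ)⁻¹ := by
    rw [← Complex.ofReal_mul, div_mul_div_comm, Real.mul_self_sqrt (by positivity)]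
    push_cast
    ring
  have hfib : ∀ η ∈ Ioo (0 : ℝ) 1, ∑ j ∈ Finset.range (n + 1), fiber t (kernelDensity μ t n) j η =
      ((1 / Real.sqrt (2 * Real.pi) : ℝ) : ℂ) *
        entrySum (toeplitzMatrix μ (fiberSize t n η))⁻¹ := by
    rintro η ⟨h0, h1⟩
    simp only [fiber_kernelDensity μ hn hn' h0.le h1]
    rw [← Finset.mul_sum, sum_toeplitzSolution_succ μ (fiberSize_eq t n η)]
  have hstep : ∫ η in Ioo (0 : ℝ) 1, entrySum (toeplitzMatrix μ (fiberSize t n η))⁻¹ =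
      (2 * t - n) * entrySum (toeplitzMatrix μ (n + 1))⁻¹ +
        (n + 1 - 2 * t) * entrySum (toeplitzMatrix μ n)⁻¹ := by
    have e1 : ∀ η ∈ Ioc (0 : ℝ) (2 * t - n), entrySum (toeplitzMatrix μ (fiberSize t n η))⁻¹ =
        entrySum (toeplitzMatrix μ (n + 1))⁻¹ := fun η hη => by rw [fiberSize, if_pos hη.2]
    have e2 : ∀ η ∈ Ioc (2 * t - n) 1, entrySum (toeplitzMatrix μ (fiberSize t n η))⁻¹ =
        entrySum (toeplitzMatrix μ n)⁻¹ := fun η hη => by rw [fiberSize, if_neg (not_le.mpr hη.1)]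
    rw [← integral_Ioc_eq_integral_Ioo, ← Ioc_union_Ioc_eq_Ioc (b := 2 * t - n) (by linarith)
      (by linarith), setIntegral_union (Ioc_disjoint_Ioc_of_le le_rfl) measurableSet_Ioc
      ((integrableOn_congr_fun e1 measurableSet_Ioc).mpr (by simp))
      ((integrableOn_congr_fun e2 measurableSet_Ioc).mpr (by simp)),
      setIntegral_congr_fun measurableSet_Ioc e1, setIntegral_congr_fun measurableSet_Ioc e2,
      setIntegral_const, setIntegral_const, Real.volume_real_Ioc_of_le (by linarith),
      Real.volume_real_Ioc_of_le (by linarith), Complex.real_smul, Complex.real_smul]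
    push_cast
    ring
  rw [hμ.kernelAtZero_eq hn hn', PaleyWiener.ofDensity_apply, fourierExt]
  simp only [mul_zero, neg_zero, Complex.exp_zero, one_mul]
  rw [setIntegral_Icc_eq_sum_fiber hD hN, ← intervalIntegral.integral_finsetSum fun j _ =>
    (integrable_fiber hD j).intervalIntegrable, intervalIntegral.integral_of_le zero_le_one,
    integral_Ioc_eq_integral_Ioo, setIntegral_congr_fun measurableSet_Ioo hfib, integral_const_mul,
    hstep, ← mul_assoc, h2]

theorem MPlusCircle.hasDerivAt_kernelAtZero {μ : Measure ℝ} (hμ : MPlusCircle μ) {t : ℝ}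
    {n : ℕ} (hn : (n : ℝ) / 2 < t) (hn' : t < ((n : ℝ) + 1) / 2) :
    HasDerivAt (fun s : ℝ => kernelAtZero μ s 0)
      ((Real.pi : ℂ)⁻¹ * (entrySum (toeplitzMatrix μ (n + 1))⁻¹ -
        entrySum (toeplitzMatrix μ n)⁻¹)) t := by
  set A := entrySum (toeplitzMatrix μ (n + 1))⁻¹
  set B := entrySum (toeplitzMatrix μ n)⁻¹
  have h1 : HasDerivAt (fun s : ℝ => (2 : ℂ) * (s : ℂ)) (2 * 1) t :=
    (HasDerivAt.ofReal_comp (hasDerivAt_id t)).const_mul 2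
  have h2 : HasDerivAt (fun s : ℝ => (2 * Real.pi : ℂ)⁻¹ * ((2 * s - n) * A + (n + 1 - 2 * s) * B))
      ((2 * Real.pi : ℂ)⁻¹ * ((2 * 1) * A + (-(2 * 1)) * B)) t :=
    (((h1.sub_const _).mul_const A).add ((h1.const_sub _).mul_const B)).const_mul _
  have hpi : (Real.pi : ℂ) ≠ 0 := by exact_mod_cast Real.pi_ne_zero
  have h3 : (fun s : ℝ => kernelAtZero μ s 0) =ᶠ[nhds t]
      fun s : ℝ => (2 * Real.pi : ℂ)⁻¹ * ((2 * s - n) * A + (n + 1 - 2 * s) * B) := by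
    -- On the open interval around `t` the integer `n` is fixed, so one affine formula holds near
    -- `t`.
    filter_upwards [Ioo_mem_nhds hn hn'] with s hs
    exact hμ.kernelAtZero_apply_zero (by linarith [hs.1]) (by linarith [hs.2])
  have e : (Real.pi : ℂ)⁻¹ * (A - B) = (2 * Real.pi : ℂ)⁻¹ * ((2 * 1) * A + (-(2 * 1)) * B) := by
    field_simp
    ring
  rw [e]
  exact h2.congr_of_eventuallyEq h3

theorem entrySum_inv_zero (μ : Measure ℝ) : entrySum (toeplitzMatrix μ 0)⁻¹ = 0 := by
  simp [entrySum]

theorem entrySum_inv_one (μ : Measure ℝ) : entrySum (toeplitzMatrix μ 1)⁻¹ = (moment μ 0)⁻¹ := by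
  simp [entrySum, toeplitzMatrix, Matrix.inv_subsingleton]

theorem ofReal_re_entrySum_inv (μ : Measure ℝ) (n : ℕ) :
    ((entrySum (toeplitzMatrix μ n)⁻¹).re : ℂ) = entrySum (toeplitzMatrix μ n)⁻¹ :=
  Complex.conj_eq_iff_re.mp (conj_entrySum (isHermitian_toeplitzMatrix μ n).inv)

end PWInverse

end

theorem mainTheorem10 (μ : MeasureTheory.Measure ℝ) (hμ : PWInverse.MPlusCircle μ) :
    (∀ t : ℝ, 0 < t →
      PWInverse.IsTruncatedToeplitz μ t (PWInverse.truncatedToeplitz μ t) ∧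
        IsUnit (PWInverse.truncatedToeplitz μ t)) ∧
    (∀ n : ℕ, IsUnit (PWInverse.toeplitzMatrix μ n)) ∧
    ∃ h : ℕ → ℝ,
      (∀ (n : ℕ) (t : ℝ), (n : ℝ) / 2 < t → t < ((n : ℝ) + 1) / 2 →
        DifferentiableAt ℝ (fun s : ℝ => PWInverse.kernelAtZero μ s 0) t ∧
          PWInverse.hFun μ t = (h n : ℂ)) ∧
      (∀ n : ℕ, (h n : ℂ) =
        PWInverse.entrySum (PWInverse.toeplitzMatrix μ (n + 1))⁻¹ -
          PWInverse.entrySum (PWInverse.toeplitzMatrix μ n)⁻¹) ∧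
      (h 0 : ℂ) = PWInverse.entrySum (PWInverse.toeplitzMatrix μ 1)⁻¹ ∧
      (h 0 : ℂ) = (PWInverse.moment μ 0)⁻¹ := by
  have hh : ∀ n : ℕ, (((PWInverse.entrySum (PWInverse.toeplitzMatrix μ (n + 1))⁻¹).re -
      (PWInverse.entrySum (PWInverse.toeplitzMatrix μ n)⁻¹).re : ℝ) : ℂ) =
        PWInverse.entrySum (PWInverse.toeplitzMatrix μ (n + 1))⁻¹ -
          PWInverse.entrySum (PWInverse.toeplitzMatrix μ n)⁻¹ := fun n => by
    rw [Complex.ofReal_sub, PWInverse.ofReal_re_entrySum_inv, PWInverse.ofReal_re_entrySum_inv]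
  refine ⟨fun t _ => hμ.isTruncatedToeplitz t, hμ.isUnit_toeplitzMatrix,
    fun n => (PWInverse.entrySum (PWInverse.toeplitzMatrix μ (n + 1))⁻¹).re -
      (PWInverse.entrySum (PWInverse.toeplitzMatrix μ n)⁻¹).re, fun n t h1 h2 => ?_, hh, ?_, ?_⟩
  · have hd := hμ.hasDerivAt_kernelAtZero h1 h2
    have hpi : (Real.pi : ℂ) ≠ 0 := by exact_mod_cast Real.pi_ne_zero
    refine ⟨hd.differentiableAt, ?_⟩
    rw [PWInverse.hFun, hd.deriv, mul_inv_cancel_left₀ hpi, hh]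
  · exact (hh 0).trans (by rw [PWInverse.entrySum_inv_zero, sub_zero])
  · exact (hh 0).trans (by rw [PWInverse.entrySum_inv_zero, sub_zero, PWInverse.entrySum_inv_one])
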